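/- Let $g\ge 1$ be an integer, $q>1$ real, and let $P_g(x)=\sum_{k=0}^{g-1}c_k(x^{2g-k}+x^k)+c_gx^g$ with $c_0,\dots,c_g\in\mathbb R$, $c_0\ne 0$. Let $T=\{z\in\mathbb C:|z|=1\}$. \emph{The linear system.} For $k\ge 0$ let $V_k^+$ be the $(\lfloor\frac{k+1}{2}\rfloor+1)\times(k+1)$ matrix whose $i$-th row ($i=0,1,\dots$; columns also numbered from $0$) has the entry $1$ in the columns $i$ and $k+1-i$ (when these exist) and $0$ elsewhere; let $V_k^-$ be the $(\lfloor\frac k2\rfloor+1)\times(k+1)$ matrix whose $i$-th row has $1$ in column $i$, $-1$ in column $k+1-i$ (when it exists) and $0$ elsewhere; let $W_k^\pm$ be defined by the same rules with $k+2$ columns. Put $$P_k(m)=\begin{bmatrix}V_k^+&0\\0&V_k^-\\ [\,0\;I_k]&-m[\,0\;I_k]\end{bmatrix},\qquad Q_k=\begin{bmatrix}W_k^+&0\\0&W_k^-\\0&0\end{bmatrix},$$ of sizes $(2k+2)\times(2k+2)$ and $(2k+2)\times(2k+4)$. Over the field of rational functions over $\mathbb Q$ in the variables $c_0,\dots,c_g,q^\omega$,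 let $v_g(0)$ be the column vector of length $4g+2$ formed by two copies of $(c_0q^{g\omega},\dots,c_{g-1}q^{\omega},c_g,c_{g-1}q^{-\omega},\dots,c_0q^{-g\omega})$, and for $1\le n\le 2g$ define $$m_{2g-n}=\frac{v_g(n-1)[1]+v_g(n-1)[2g-n+2]}{v_g(n-1)[2g-n+3]-v_g(n-1)[4g-2n+4]},\qquad v_g(n)=P_{2g-n}(m_{2g-n})^{-1}Q_{2g-n}\,v_g(n-1),$$ where $v[j]$ is the $j$-th component of $v$. The real numbers $c_0,\dots,c_g$ and $q^\omega$ are then substituted into these rational functions (a value being defined where the denominator in lowest terms does not vanish). \emph{The functions.} For $\omega>0$, $1\le n\le 2g$ and $q^{(n-1)/2}\le a<q^{n/2}$ put $m_{q,\omega}(a)=m_{2g-n}$, $H_{q,\omega}(a)=\mathrm{diag}(m_{q,\omega}(a)^{-1},m_{q,\omega}(a))$ (defined if both entries are finite) and $$A_{q,\omega}(a,z)=\frac12\sum_{j=0}^{2g-n}\Bigl((q^{g-j}/a)^{iz}+(q^{g-j}/a)^{-iz}\Bigr)v_g(n)[j+1],$$ $$B_{q,\omega}(a,z)=-\frac i2\sum_{j=0}^{2g-n}\Bigl((q^{g-j}/a)^{iz}-(q^{g-j}/a)^{-iz}\Bigr)v_g(n)[2g-n+2+j].$$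 Let $A_q(z)=q^{-giz}P_g(q^{iz})$ and $E_{q,\omega}(z)=A_q(z+i\omega)$. \emph{Canonical systems.} A real $2\times2$ matrix-valued function $H$ defined almost everywhere on $I=[a_1,a_0)$ is said to define a canonical system on $I$, namely $$-a\frac{\partial}{\partial a}\begin{bmatrix}A(a,z)\\B(a,z)\end{bmatrix}=z\begin{bmatrix}0&-1\\1&0\end{bmatrix}H(a)\begin{bmatrix}A(a,z)\\B(a,z)\end{bmatrix},\qquad \lim_{a\to a_0^-}\begin{bmatrix}A(a,z)\\B(a,z)\end{bmatrix}=\begin{bmatrix}1\\0\end{bmatrix}\qquad(z\in\mathbb C),$$ if $H(a)$ is symmetric positive semidefinite for almost every $a\in I$, $H$ does not vanish identically (almost everywhere) on any relatively open subset of $I$ of positive Lebesgue measure, and $H$ is locally integrable on $I$. A solution is a pair $(A,B)$ that for every $z\in\mathbb C$ is locally absolutely continuous in $a\in I$, satisfies the differential equation for almost every $a\in I$, and satisfies the limit condition. \textbf{Statement.} $H_{q,\omega}$ defines a canonical system on $[1,q^g)$ for every $\omega>0$ if and only if all zeros of $P_g$ lie on $T$ (multiple zeros allowed). Moreover, for each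 $\omega>0$ for which $H_{q,\omega}$ defines a canonical system on $[1,q^g)$, one has $E_{q,\omega}(0)\ne 0$, the functions $A_{q,\omega}(a,z)$ and $B_{q,\omega}(a,z)$ are defined for all $a\in[1,q^g)$, and $(A_{q,\omega}(a,z)/E_{q,\omega}(0),\,B_{q,\omega}(a,z)/E_{q,\omega}(0))$ is a solution of this canonical system. -/

import Mathlib

open MeasureTheory Filter Topology

noncomputable section

namespace SelfReciprocal

/-! ### The linear system over a field

All vectors are stored with 0-based indices as functions `ℕ → F` that vanish beyond their
length: the component `v[j]` of the text (1-based) is `v (j - 1)`. -/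

section LinearSystem

variable {F : Type*} [Field F]

/-- Entries of the blocks `V_k^+` (with `k + 1` columns) and `W_k^+` (with `k + 2` columns):
row `i` has a `1` in the columns `i` and `k + 1 - i`. -/
def plusEntry (F : Type*) [Field F] (k i j : ℕ) : F :=
  if j = i ∨ i + j = k + 1 then 1 else 0

/-- Entries of the blocks `V_k^-` (with `k + 1` columns) and `W_k^-` (with `k + 2` columns):
row `i` has a `1` in column `i` and a `-1` in column `k + 1 - i`. -/
def minusEntry (F : Type*) [Field F] (k i j : ℕ) : F :=
  if j = i then 1 else if i + j = k + 1 then -1 else 0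

/-- The number of rows of `V_k^+` and `W_k^+`: `(k+3)/2` for odd `k`, `(k+2)/2` for even `k`.
(The blocks `V_k^-` and `W_k^-` have the remaining `k + 2 - plusRows k` rows.) -/
def plusRows (k : ℕ) : ℕ := (k + 1) / 2 + 1

/-- The `(2k+2) × (2k+2)` matrix `P_k(m)` with block rows `[V_k^+ | 0]`, `[0 | V_k^-]` and
`[0 I_k | -m · 0 I_k]`. -/
def matP (k : ℕ) (m : F) : Matrix (Fin (2 * k + 2)) (Fin (2 * k + 2)) F :=
  Matrix.of fun i j =>
    if (i : ℕ) < plusRows k then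
      if (j : ℕ) < k + 1 then plusEntry F k i j else 0
    else if (i : ℕ) < k + 2 then
      if (j : ℕ) < k + 1 then 0 else minusEntry F k (i - plusRows k) (j - (k + 1))
    else
      if (j : ℕ) < k + 1 then (if (j : ℕ) = (i - (k + 2)) + 1 then 1 else 0)
      else (if (j : ℕ) - (k + 1) = (i - (k + 2)) + 1 then -m else 0)

/-- The `(2k+2) × (2k+4)` matrix `Q_k` with block rows `[W_k^+ | 0]`, `[0 | W_k^-]` and
`[0 | 0]`. -/
def matQ (F : Type*) [Field F] (k : ℕ) : Matrix (Fin (2 * k + 2)) (Fin (2 * k + 4)) F :=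
  Matrix.of fun i j =>
    if (i : ℕ) < plusRows k then
      if (j : ℕ) < k + 2 then plusEntry F k i j else 0
    else if (i : ℕ) < k + 2 then
      if (j : ℕ) < k + 2 then 0 else minusEntry F k (i - plusRows k) (j - (k + 2))
    else 0

/-- `m_k` computed from the vector `u` of length `2k + 4`:
`(u[1] + u[k+2]) / (u[k+3] - u[2k+4])`. -/
def mStep (k : ℕ) (u : ℕ → F) : F := (u 0 + u (k + 1)) / (u (k + 2) - u (2 * k + 3))

/-- The vector `P_k(m_k)⁻¹ Q_k u` of length `2k + 2`. -/
def vStep (k : ℕ) (u : ℕ → F) : ℕ → F := fun j =>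
  if h : j < 2 * k + 2 then
    (((matP k (mStep k u))⁻¹ * matQ F k).mulVec fun i : Fin (2 * k + 4) => u i) ⟨j, h⟩
  else 0

/-- The vectors `v_g(n)` of length `4g - 2n + 2` for a given initial vector `v_g(0)`. -/
def vSeq (g : ℕ) (v0 : ℕ → F) : ℕ → ℕ → F
  | 0 => v0
  | n + 1 => vStep (2 * g - (n + 1)) (vSeq g v0 n)

/-- The quantities `m_{2g-n}`, `1 ≤ n ≤ 2g`, for a given initial vector `v_g(0)`. -/
def mSeq (g : ℕ) (v0 : ℕ → F) (n : ℕ) : F := mStep (2 * g - n) (vSeq g v0 (n - 1))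

end LinearSystem

/-! ### The rational functions `v_g(n)` and `m_{2g-n}` and their values -/

/-- Polynomials over `ℚ` in the variables `c_0, …, c_g` (`some k` is `c_k`) and `q^ω` (`none`). -/
abbrev Poly (g : ℕ) : Type := MvPolynomial (Option (Fin (g + 1))) ℚ

/-- The field `ℚ(c_0, …, c_g, q^ω)`. -/
abbrev RatField (g : ℕ) : Type := FractionRing (Poly g)

/-- The initial vector: two copies of
`(c_0 q^{gω}, …, c_{g-1} q^ω, c_g, c_{g-1} q^{-ω}, …, c_0 q^{-gω})`. -/
def initVec (g : ℕ) : ℕ → RatField g := fun j =>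
  let entry : ℕ → RatField g := fun i =>
    algebraMap (Poly g) (RatField g)
        (MvPolynomial.X (some ⟨min i (2 * g - i), by omega⟩)) *
      (algebraMap (Poly g) (RatField g) (MvPolynomial.X none)) ^ ((g : ℤ) - (i : ℤ))
  if j < 2 * g + 1 then entry j
  else if j < 4 * g + 2 then entry (j - (2 * g + 1))
  else 0

/-- `v_g(n)` as a vector of rational functions of `c` and `q^ω`. -/
def vRat (g n : ℕ) : ℕ → RatField g := vSeq g (initVec g) n

/-- `m_{2g-n}` as a rational function of `c` and `q^ω`. -/
def mRat (g n : ℕ) : RatField g := mSeq g (initVec g) n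

/-- The numerical point `(c, x)` for the variables `(c_0, …, c_g, q^ω)`. -/
def point {g : ℕ} (c : Fin (g + 1) → ℝ) (x : ℝ) : Option (Fin (g + 1)) → ℝ
  | some k => c k
  | none => x

/-- The rational function `f` is defined (finite) at the point `p`: its denominator in lowest
terms does not vanish there. -/
def RatDefined {g : ℕ} (f : RatField g) (p : Option (Fin (g + 1)) → ℝ) : Prop :=
  MvPolynomial.aeval p (IsFractionRing.den (Poly g) f : Poly g) ≠ 0

/-- The value of the rational function `f` at the point `p` (meaningful where it is defined). -/
def ratValue {g : ℕ} (f : RatField g) (p : Option (Fin (g + 1)) → ℝ) : ℝ :=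
  MvPolynomial.aeval p (IsFractionRing.num (Poly g) f) /
    MvPolynomial.aeval p (IsFractionRing.den (Poly g) f : Poly g)

/-! ### The polynomial and the functions attached to it -/

/-- `P_g(x) = ∑_{k<g} c_k (x^{2g-k} + x^k) + c_g x^g`. -/
def polyP {g : ℕ} (c : Fin (g + 1) → ℝ) : Polynomial ℝ :=
  ∑ k : Fin g, Polynomial.C (c k.castSucc) *
      (Polynomial.X ^ (2 * g - (k : ℕ)) + Polynomial.X ^ (k : ℕ)) +
    Polynomial.C (c (Fin.last g)) * Polynomial.X ^ g

/-- `A_q(z) = q^{-giz} P_g(q^{iz})`. -/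
def Aq {g : ℕ} (c : Fin (g + 1) → ℝ) (q : ℝ) (z : ℂ) : ℂ :=
  (q : ℂ) ^ (-(g : ℂ) * Complex.I * z) *
    Polynomial.aeval ((q : ℂ) ^ (Complex.I * z)) (polyP c)

/-- `E_{q,ω}(z) = A_q(z + iω)`. -/
def Eqω {g : ℕ} (c : Fin (g + 1) → ℝ) (q ω : ℝ) (z : ℂ) : ℂ := Aq c q (z + Complex.I * ω)

/-- The interval `[q^{(n-1)/2}, q^{n/2})`. -/
def piece (q : ℝ) (n : ℕ) : Set ℝ := Set.Ico (q ^ (((n : ℝ) - 1) / 2)) (q ^ ((n : ℝ) / 2))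

/-- `m_{q,ω}(a) = m_{2g-n}(c; q^ω)` for `q^{(n-1)/2} ≤ a < q^{n/2}`, `1 ≤ n ≤ 2g`. -/
def mqω {g : ℕ} (c : Fin (g + 1) → ℝ) (q ω a : ℝ) : ℝ :=
  ∑ n ∈ Finset.Icc 1 (2 * g),
    (piece q n).indicator (fun _ => ratValue (mRat g n) (point c (q ^ ω))) a

/-- The matrix `H_{q,ω}(a) = diag(m_{q,ω}(a)⁻¹, m_{q,ω}(a))`. -/
def Hqω {g : ℕ} (c : Fin (g + 1) → ℝ) (q ω a : ℝ) : Matrix (Fin 2) (Fin 2) ℝ :=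
  !![(mqω c q ω a)⁻¹, 0; 0, mqω c q ω a]

/-- The set of all `a` at which `H_{q,ω}(a)` is defined, i.e. at which `m_{q,ω}(a)` and
`m_{q,ω}(a)⁻¹` are both finite. -/
def HqωDomain {g : ℕ} (c : Fin (g + 1) → ℝ) (q ω : ℝ) : Set ℝ :=
  {a | ∃ n ∈ Finset.Icc 1 (2 * g), a ∈ piece q n ∧
    RatDefined (mRat g n) (point c (q ^ ω)) ∧ ratValue (mRat g n) (point c (q ^ ω)) ≠ 0}

/-- `c_k(a,z) = (q^k/a)^{iz} + (q^k/a)^{-iz}`. -/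
def cFun (q : ℝ) (k : ℤ) (a : ℝ) (z : ℂ) : ℂ :=
  ((q ^ k / a : ℝ) : ℂ) ^ (Complex.I * z) + ((q ^ k / a : ℝ) : ℂ) ^ (-(Complex.I * z))

/-- `s_k(a,z) = (q^k/a)^{iz} - (q^k/a)^{-iz}`. -/
def sFun (q : ℝ) (k : ℤ) (a : ℝ) (z : ℂ) : ℂ :=
  ((q ^ k / a : ℝ) : ℂ) ^ (Complex.I * z) - ((q ^ k / a : ℝ) : ℂ) ^ (-(Complex.I * z))

/-- The vector `T_n(a,z) v` for a vector `v` of length `4g - 2n + 2`. The nonzero entries of the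
first row of `T_n(a,z)` are `c_g, c_{g-1}, …, c_{-g+n}` in the first `2g - n + 1` columns, those of
the second row are `s_g, s_{g-1}, …, s_{-g+n}` in the last `2g - n + 1` columns. -/
def applyT (g n : ℕ) (q a : ℝ) (z : ℂ) (v : ℕ → ℝ) : Fin 2 → ℂ :=
  ![∑ j ∈ Finset.range (2 * g - n + 1), cFun q ((g : ℤ) - (j : ℤ)) a z * (v j : ℂ),
    ∑ j ∈ Finset.range (2 * g - n + 1),
      sFun q ((g : ℤ) - (j : ℤ)) a z * (v (2 * g - n + 1 + j) : ℂ)]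

/-- The vector `(A_{q,ω}(a,z), B_{q,ω}(a,z)) = ½ diag(1, -i) T_n(a,z) v_g(n)` for
`q^{(n-1)/2} ≤ a < q^{n/2}`, `1 ≤ n ≤ 2g`. -/
def ABqω {g : ℕ} (c : Fin (g + 1) → ℝ) (q ω a : ℝ) (z : ℂ) : Fin 2 → ℂ :=
  ∑ n ∈ Finset.Icc 1 (2 * g),
    (piece q n).indicator (fun a => (1 / 2 : ℂ) •
      (!![1, 0; 0, -Complex.I] : Matrix (Fin 2) (Fin 2) ℂ).mulVec
        (applyT g n q a z fun j => ratValue (vRat g n j) (point c (q ^ ω)))) a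

/-- The set of all `a` at which `A_{q,ω}(a,z)` and `B_{q,ω}(a,z)` are defined, i.e. at which all
components of the vector `v_g(n)` in their definition are finite. -/
def ABqωDomain {g : ℕ} (c : Fin (g + 1) → ℝ) (q ω : ℝ) : Set ℝ :=
  {a | ∃ n ∈ Finset.Icc 1 (2 * g), a ∈ piece q n ∧
    ∀ j < 4 * g - 2 * n + 2, RatDefined (vRat g n j) (point c (q ^ ω))}

/-! ### Canonical systems -/

/-- The matrix-valued function `H`, defined on the set `D`, defines a canonical system on
`I = [a₁, a₀)`:
`-a ∂Y/∂a = z [0, -1; 1, 0] H(a) Y`, `Y(a, z) → (1, 0)` as `a → a₀⁻` (`z ∈ ℂ`). -/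
structure IsCanonicalSystem (a₁ a₀ : ℝ) (D : Set ℝ) (H : ℝ → Matrix (Fin 2) (Fin 2) ℝ) :
    Prop where
  /-- The interval is nondegenerate. -/
  lt : a₁ < a₀
  /-- `H` is defined almost everywhere on `I`. -/
  defined : ∀ᵐ a ∂(volume.restrict (Set.Ico a₁ a₀)), a ∈ D
  /-- (H1) `H(a)` is symmetric and positive semidefinite for almost every `a ∈ I`. -/
  posSemidef : ∀ᵐ a ∂(volume.restrict (Set.Ico a₁ a₀)), (H a).PosSemidef
  /-- (H2) `H` does not vanish (a.e.) on any relatively open subset of `I` of positive measure. -/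
  nonvanishing : ∀ U : Set ℝ, IsOpen U → 0 < volume (U ∩ Set.Ico a₁ a₀) →
    ¬ ∀ᵐ a ∂(volume.restrict (U ∩ Set.Ico a₁ a₀)), H a = 0
  /-- (H3) `H` is locally integrable on `I`. -/
  locallyIntegrable : ∀ i j, LocallyIntegrableOn (fun a => H a i j) (Set.Ico a₁ a₀) volume

/-- `Y` is a solution of the canonical system with Hamiltonian `H` on `[a₁, a₀)`: for every
`z ∈ ℂ` the function `Y(·, z)` is locally absolutely continuous on `[a₁, a₀)`, satisfies the
differential equation almost everywhere, and tends to `(1, 0)` at `a₀` from the left. -/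
def IsCanonicalSolution (a₁ a₀ : ℝ) (H : ℝ → Matrix (Fin 2) (Fin 2) ℝ)
    (Y : ℝ → ℂ → Fin 2 → ℂ) : Prop :=
  ∀ z : ℂ,
    (∀ b ∈ Set.Ico a₁ a₀, AbsolutelyContinuousOnInterval (fun a => Y a z) a₁ b) ∧
    (∀ᵐ a ∂(volume.restrict (Set.Ico a₁ a₀)), ∃ Y' : Fin 2 → ℂ,
      HasDerivAt (fun t => Y t z) Y' a ∧
      -(a : ℂ) • Y' = z • ((!![0, -1; 1, 0] : Matrix (Fin 2) (Fin 2) ℂ) *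
        (H a).map Complex.ofReal).mulVec (Y a z)) ∧
    Tendsto (fun a => Y a z) (𝓝[<] a₀) (𝓝 ![1, 0])

end SelfReciprocal

end

noncomputable section

namespace SelfReciprocal

/-! ### One step of the linear system -/

section LinearStep

variable {F : Type*} [Field F]

/-- One step of the Schur–Cohn recursion for the coefficient vector `s` of a polynomial of degree
at most `N`. -/
def schurStep (N : ℕ) (s : ℕ → F) : ℕ → F :=
  fun j => (s 0 * s j - s N * s (N - j)) / (s 0 - s N)

lemma sum_fin_double (n : ℕ) (f : ℕ → F) {l : ℕ} (hl : l = n + n) :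
    ∑ j : Fin l, f j = ∑ j ∈ Finset.range n, f j + ∑ j ∈ Finset.range n, f (n + j) := by
  subst hl
  rw [Fin.sum_univ_eq_sum_range, Finset.sum_range_add]

lemma sum_plusEntry {k i n : ℕ} (hi : i < n) (hik : 2 * i ≤ k + 1) (x : ℕ → F) :
    ∑ j ∈ Finset.range n, plusEntry F k i j * x j =
      x i + if k + 1 - i < n ∧ 2 * i ≠ k + 1 then x (k + 1 - i) else 0 := by
  have h1 : ∀ j, plusEntry F k i j * x j = (if j = i then x i else 0) +
      if j = k + 1 - i then (if 2 * i ≠ k + 1 then x (k + 1 - i) else 0) else 0 := by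
    intro j
    unfold plusEntry
    by_cases h : j = i
    · subst h
      by_cases h2 : 2 * j = k + 1
      · simp [h2]
      · have : j ≠ k + 1 - j := by omega
        simp [this]
    · by_cases h2 : i + j = k + 1
      · have h3 : j = k + 1 - i := by omega
        have h4 : 2 * i ≠ k + 1 := by omega
        simp [h2, h, h4, ← h3]
      · have h3 : j ≠ k + 1 - i := by omega
        simp [h2, h, h3]
  simp only [h1, Finset.sum_add_distrib, Finset.sum_ite_eq', Finset.mem_range, hi, if_true]
  congr 1
  by_cases h : k + 1 - i < n <;> simp [h]

lemma sum_minusEntry {k i n : ℕ} (hi : i < n) (hik : 2 * i < k + 1) (x : ℕ → F) :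
    ∑ j ∈ Finset.range n, minusEntry F k i j * x j =
      x i - if k + 1 - i < n then x (k + 1 - i) else 0 := by
  have h1 : ∀ j, minusEntry F k i j * x j = (if j = i then x i else 0) -
      if j = k + 1 - i then x (k + 1 - i) else 0 := by
    intro j
    unfold minusEntry
    by_cases h : j = i
    · subst h
      have : j ≠ k + 1 - j := by omega
      simp [this]
    · by_cases h2 : i + j = k + 1
      · have h3 : j = k + 1 - i := by omega
        simp [h2, h, ← h3]
      · have h3 : j ≠ k + 1 - i := by omega
        simp [h2, h, h3]
  simp only [h1, Finset.sum_sub_distrib, Finset.sum_ite_eq', Finset.mem_range, hi, if_true]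

lemma matP_mulVec_plus {k : ℕ} (m : F) (x : ℕ → F) {i : ℕ} (hi : i < plusRows k)
    (hi' : i < 2 * k + 2) :
    (matP k m).mulVec (fun j => x j) ⟨i, hi'⟩ =
      x i + if 1 ≤ i ∧ 2 * i ≠ k + 1 then x (k + 1 - i) else 0 := by
  have hi2 : 2 * i ≤ k + 1 := by unfold plusRows at hi; omega
  obtain ⟨f, hf⟩ : ∃ f : ℕ → F, f = fun j : ℕ =>
      (if j < k + 1 then plusEntry F k i j else 0) * x j := ⟨_, rfl⟩
  have : (matP k m).mulVec (fun j => x j) ⟨i, hi'⟩ = ∑ j : Fin (2 * k + 2), f j := by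
    simp [hf, Matrix.mulVec, dotProduct, matP, hi]
  rw [this, sum_fin_double (k + 1) f (by omega), hf]
  clear this
  have h2 : ∀ j ∈ Finset.range (k + 1), (if j < k + 1 then plusEntry F k i j else 0) * x j =
      plusEntry F k i j * x j := by
    intro j hj; simp [Finset.mem_range.1 hj]
  rw [Finset.sum_congr rfl h2, sum_plusEntry (by omega) hi2]
  have : k + 1 - i < k + 1 ↔ 1 ≤ i := by omega
  have h3 : ∀ j, ¬ k + 1 + j < k + 1 := by omega
  simp only [this, h3, if_false, zero_mul, Finset.sum_const_zero, add_zero]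

lemma matP_mulVec_minus {k : ℕ} (m : F) (x : ℕ → F) {i : ℕ} (hi : 2 * i < k + 1)
    (hi' : plusRows k + i < 2 * k + 2) :
    (matP k m).mulVec (fun j => x j) ⟨plusRows k + i, hi'⟩ =
      x (k + 1 + i) - if 1 ≤ i then x (k + 1 + (k + 1 - i)) else 0 := by
  have h1 : plusRows k + i < k + 2 := by unfold plusRows; omega
  obtain ⟨f, hf⟩ : ∃ f : ℕ → F, f = fun j : ℕ =>
      (if j < k + 1 then 0 else minusEntry F k i (j - (k + 1))) * x j := ⟨_, rfl⟩
  have : (matP k m).mulVec (fun j => x j) ⟨plusRows k + i, hi'⟩ = ∑ j : Fin (2 * k + 2), f j := by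
    simp [hf, Matrix.mulVec, dotProduct, matP, h1]
  rw [this, sum_fin_double (k + 1) f (by omega), hf]
  clear this
  have h2 : ∀ j ∈ Finset.range (k + 1),
      (if j < k + 1 then 0 else minusEntry F k i (j - (k + 1))) * x j = 0 := by
    intro j hj; simp [Finset.mem_range.1 hj]
  rw [Finset.sum_congr rfl h2]
  simp only [Finset.sum_const_zero, zero_add, add_lt_iff_neg_left, not_lt_zero, if_false,
    add_tsub_cancel_left]
  rw [sum_minusEntry (by omega) hi (fun j => x (k + 1 + j))]
  have : k + 1 - i < k + 1 ↔ 1 ≤ i := by omega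
  simp [this]

lemma matP_mulVec_rel {k : ℕ} (m : F) (x : ℕ → F) {i : ℕ} (hi : i < k)
    (hi' : k + 2 + i < 2 * k + 2) :
    (matP k m).mulVec (fun j => x j) ⟨k + 2 + i, hi'⟩ = x (i + 1) - m * x (k + 1 + (i + 1)) := by
  have h1 : ¬ k + 2 + i < plusRows k := by unfold plusRows; omega
  have h1' : ¬ k + 2 + i < k + 2 := by omega
  obtain ⟨f, hf⟩ : ∃ f : ℕ → F, f = fun j : ℕ => (if j < k + 1 then (if j = i + 1 then 1 else 0)
        else (if j - (k + 1) = i + 1 then -m else 0)) * x j := ⟨_, rfl⟩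
  have : (matP k m).mulVec (fun j => x j) ⟨k + 2 + i, hi'⟩ = ∑ j : Fin (2 * k + 2), f j := by
    simp [hf, Matrix.mulVec, dotProduct, matP, h1]
  rw [this, sum_fin_double (k + 1) f (by omega), hf]
  clear this
  have h2 : ∀ j ∈ Finset.range (k + 1),
      (if j < k + 1 then (if j = i + 1 then (1 : F) else 0)
        else (if j - (k + 1) = i + 1 then -m else 0)) * x j = if j = i + 1 then x (i + 1) else 0 := by
    intro j hj
    rw [if_pos (Finset.mem_range.1 hj)]
    by_cases h : j = i + 1 <;> simp [h]
  have h3 : ∀ j ∈ Finset.range (k + 1),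
      (if k + 1 + j < k + 1 then (if k + 1 + j = i + 1 then (1 : F) else 0)
        else (if k + 1 + j - (k + 1) = i + 1 then -m else 0)) * x (k + 1 + j) =
      if j = i + 1 then -m * x (k + 1 + (i + 1)) else 0 := by
    intro j hj
    rw [if_neg (by omega), add_tsub_cancel_left]
    by_cases h : j = i + 1 <;> simp [h]
  rw [Finset.sum_congr rfl h2, Finset.sum_congr rfl h3]
  simp [hi]
  ring

lemma matQ_mulVec_plus {k : ℕ} (x : ℕ → F) {i : ℕ} (hi : i < plusRows k)
    (hi' : i < 2 * k + 2) :
    (matQ F k).mulVec (fun j => x j) ⟨i, hi'⟩ =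
      x i + if 2 * i ≠ k + 1 then x (k + 1 - i) else 0 := by
  have hi2 : 2 * i ≤ k + 1 := by unfold plusRows at hi; omega
  obtain ⟨f, hf⟩ : ∃ f : ℕ → F, f = fun j : ℕ =>
      (if j < k + 2 then plusEntry F k i j else 0) * x j := ⟨_, rfl⟩
  have : (matQ F k).mulVec (fun j => x j) ⟨i, hi'⟩ = ∑ j : Fin (2 * k + 4), f j := by
    simp [hf, Matrix.mulVec, dotProduct, matQ, hi]
  rw [this, sum_fin_double (k + 2) f (by omega), hf]
  clear this
  have h2 : ∀ j ∈ Finset.range (k + 2), (if j < k + 2 then plusEntry F k i j else 0) * x j =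
      plusEntry F k i j * x j := by
    intro j hj; simp [Finset.mem_range.1 hj]
  rw [Finset.sum_congr rfl h2, sum_plusEntry (by omega) hi2]
  have : k + 1 - i < k + 2 := by omega
  simp [this]

lemma matQ_mulVec_minus {k : ℕ} (x : ℕ → F) {i : ℕ} (hi : 2 * i < k + 1)
    (hi' : plusRows k + i < 2 * k + 2) :
    (matQ F k).mulVec (fun j => x j) ⟨plusRows k + i, hi'⟩ =
      x (k + 2 + i) - x (k + 2 + (k + 1 - i)) := by
  have h1 : plusRows k + i < k + 2 := by unfold plusRows; omega
  obtain ⟨f, hf⟩ : ∃ f : ℕ → F, f = fun j : ℕ =>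
      (if j < k + 2 then 0 else minusEntry F k i (j - (k + 2))) * x j := ⟨_, rfl⟩
  have : (matQ F k).mulVec (fun j => x j) ⟨plusRows k + i, hi'⟩ = ∑ j : Fin (2 * k + 4), f j := by
    simp [hf, Matrix.mulVec, dotProduct, matQ, h1]
  rw [this, sum_fin_double (k + 2) f (by omega), hf]
  clear this
  have h2 : ∀ j ∈ Finset.range (k + 2),
      (if j < k + 2 then 0 else minusEntry F k i (j - (k + 2))) * x j = 0 := by
    intro j hj; simp [Finset.mem_range.1 hj]
  rw [Finset.sum_congr rfl h2]
  simp only [Finset.sum_const_zero, zero_add, add_lt_iff_neg_left, not_lt_zero, if_false,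
    add_tsub_cancel_left]
  rw [sum_minusEntry (by omega) hi (fun j => x (k + 2 + j))]
  have : k + 1 - i < k + 2 := by omega
  simp [this]

lemma matQ_mulVec_zero {k : ℕ} (x : ℕ → F) {i : ℕ} (hi' : k + 2 + i < 2 * k + 2) :
    (matQ F k).mulVec (fun j => x j) ⟨k + 2 + i, hi'⟩ = 0 := by
  have h1 : ¬ k + 2 + i < plusRows k := by unfold plusRows; omega
  simp [Matrix.mulVec, dotProduct, matQ, h1]

lemma matP_mulVec_injective [CharZero F] {k : ℕ} {m : F} (hm : m ≠ 0) :
    Function.Injective (matP k m).mulVec := by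
  rw [← Matrix.coe_mulVecLin, ← LinearMap.ker_eq_bot, LinearMap.ker_eq_bot']
  intro y hy
  obtain ⟨x, rfl⟩ : ∃ x : ℕ → F, y = fun j : Fin (2 * k + 2) => x j :=
    ⟨fun j => if h : j < 2 * k + 2 then y ⟨j, h⟩ else 0, by ext j; simp⟩
  rw [Matrix.coe_mulVecLin] at hy
  have hplus : ∀ i, 2 * i ≤ k + 1 →
      x i + (if 1 ≤ i ∧ 2 * i ≠ k + 1 then x (k + 1 - i) else 0) = 0 := by
    intro i hi
    have hi' : i < 2 * k + 2 := by omega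
    rw [← matP_mulVec_plus m x (by unfold plusRows; omega) hi', hy]; rfl
  have hminus : ∀ i, 2 * i < k + 1 →
      x (k + 1 + i) - (if 1 ≤ i then x (k + 1 + (k + 1 - i)) else 0) = 0 := by
    intro i hi
    have hi' : plusRows k + i < 2 * k + 2 := by unfold plusRows; omega
    rw [← matP_mulVec_minus m x hi hi', hy]; rfl
  have hrel : ∀ i, 1 ≤ i → i ≤ k → x i = m * x (k + 1 + i) := by
    intro i hi hik
    obtain ⟨i, rfl⟩ : ∃ l, i = l + 1 := ⟨i - 1, by omega⟩
    have hi' : k + 2 + i < 2 * k + 2 := by omega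
    rw [← sub_eq_zero, ← matP_mulVec_rel m x (by omega) hi', hy]; rfl
  have key : ∀ i, 1 ≤ i → 2 * i ≤ k + 1 →
      x (k + 1 + i) = 0 ∧ x (k + 1 + (k + 1 - i)) = 0 := by
    intro i h1 h2
    have ha := hplus i h2
    by_cases h3 : 2 * i = k + 1
    · have h4 : k + 1 - i = i := by omega
      simp only [h3, ne_eq, not_true, and_false, if_false, add_zero] at ha
      rw [hrel i h1 (by omega)] at ha
      have := (mul_eq_zero.1 ha).resolve_left hm
      rw [h4]; exact ⟨this, this⟩
    · have hb := hminus i (by omega)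
      rw [if_pos ⟨h1, h3⟩, hrel i h1 (by omega), hrel (k + 1 - i) (by omega) (by omega),
        ← mul_add] at ha
      have hc := (mul_eq_zero.1 ha).resolve_left hm
      rw [if_pos h1] at hb
      have hd : 2 * x (k + 1 + i) = 0 := by linear_combination hb + hc
      have he := (mul_eq_zero.1 hd).resolve_left two_ne_zero
      refine ⟨he, ?_⟩
      rw [he, zero_add] at hc
      exact hc
  have hb : ∀ i, i ≤ k → x (k + 1 + i) = 0 := by
    intro i hi
    rcases Nat.eq_zero_or_pos i with rfl | h0
    · simpa using hminus 0 (by omega)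
    · by_cases h : 2 * i ≤ k + 1
      · exact (key i h0 h).1
      · have := (key (k + 1 - i) (by omega) (by omega)).2
        rwa [show k + 1 - (k + 1 - i) = i by omega] at this
  ext j
  rcases Nat.eq_zero_or_pos (j : ℕ) with h0 | h0
  · simpa [h0] using hplus 0 (by omega)
  · by_cases h : (j : ℕ) ≤ k
    · simp [hrel j h0 h, hb j h]
    · have := hb (j - (k + 1)) (by omega)
      rwa [show k + 1 + ((j : ℕ) - (k + 1)) = j by omega] at this

lemma vStep_eq_of_mulVec_eq [CharZero F] {k : ℕ} {u x : ℕ → F} (hm : mStep k u ≠ 0)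
    (h : (matP k (mStep k u)).mulVec (fun j => x j) = (matQ F k).mulVec (fun j => u j))
    {j : ℕ} (hj : j < 2 * k + 2) : vStep k u j = x j := by
  have hu : IsUnit (matP k (mStep k u)).det :=
    (Matrix.isUnit_iff_isUnit_det _).1
      (Matrix.mulVec_injective_iff_isUnit.1 (matP_mulVec_injective hm))
  simp only [vStep, hj, dif_pos, ← Matrix.mulVec_mulVec]
  rw [← h, Matrix.mulVec_mulVec, Matrix.nonsing_inv_mul _ hu, Matrix.one_mulVec]

lemma mStep_of_proportional {k : ℕ} {u s : ℕ → F} {m : F}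
    (ha : ∀ j < k + 2, u j = s j) (hb : ∀ j < k + 2, u (k + 2 + j) = s j / m) :
    mStep k u = m * (s 0 + s (k + 1)) / (s 0 - s (k + 1)) := by
  have h1 := hb 0 (by omega)
  have h2 := hb (k + 1) (by omega)
  rw [show k + 2 + (k + 1) = 2 * k + 3 by omega] at h2
  rw [add_zero] at h1
  rw [mStep, ha 0 (by omega), ha (k + 1) (by omega), h1, h2, ← sub_div, div_div_eq_mul_div,
    mul_comm]

lemma vStep_of_proportional [CharZero F] {k : ℕ} {u s : ℕ → F} {m : F} (hm : m ≠ 0)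
    (ha : ∀ j < k + 2, u j = s j) (hb : ∀ j < k + 2, u (k + 2 + j) = s j / m)
    (h1 : s 0 - s (k + 1) ≠ 0) (h2 : s 0 + s (k + 1) ≠ 0) :
    (∀ j < k + 1, vStep k u j = schurStep (k + 1) s j) ∧
    ∀ j < k + 1, vStep k u (k + 1 + j) = schurStep (k + 1) s j / mStep k u := by
  have hM := mStep_of_proportional ha hb
  have hM0 : mStep k u ≠ 0 := by
    rw [hM]; exact div_ne_zero (mul_ne_zero hm h2) h1
  set M := mStep k u with hMdef
  set x : ℕ → F := fun j => if j < k + 1 then schurStep (k + 1) s j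
    else schurStep (k + 1) s (j - (k + 1)) / M with hx
  have xa : ∀ j < k + 1, x j = schurStep (k + 1) s j := fun j hj => by simp only [hx, if_pos hj]
  have xb : ∀ j, x (k + 1 + j) = schurStep (k + 1) s j / M := fun j => by
    simp only [hx]
    rw [if_neg (by omega), add_tsub_cancel_left]
  have key : (matP k M).mulVec (fun j => x j) = (matQ F k).mulVec (fun j => u j) := by
    ext ⟨i, hi⟩
    by_cases hi1 : i < plusRows k
    · have hi2 : 2 * i ≤ k + 1 := by unfold plusRows at hi1; omega
      rw [matP_mulVec_plus M x hi1, matQ_mulVec_plus u hi1, xa i (by omega), ha i (by omega)]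
      by_cases h3 : 2 * i = k + 1
      · have h4 : k + 1 - i = i := by omega
        simp only [h3, ne_eq, not_true, and_false, if_false, add_zero, schurStep, h4]
        field_simp
      · rw [if_pos h3, ha _ (by omega)]
        rcases Nat.eq_zero_or_pos i with rfl | h0
        · simp only [schurStep]
          simp
          field_simp
          ring
        · rw [if_pos ⟨h0, h3⟩, xa _ (by omega)]
          simp only [schurStep]
          rw [show k + 1 - (k + 1 - i) = i by omega]
          field_simp
          ring
    · by_cases hi2 : i < k + 2
      · obtain ⟨l, rfl⟩ : ∃ l, i = plusRows k + l := ⟨i - plusRows k, by omega⟩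
        have hl : 2 * l < k + 1 := by unfold plusRows at hi2; omega
        rw [matP_mulVec_minus M x hl, matQ_mulVec_minus u hl, xb, xb, hb _ (by omega),
          hb _ (by omega), hM]
        rcases Nat.eq_zero_or_pos l with rfl | h0
        · simp only [schurStep]
          simp
          field_simp
          ring
        · rw [if_pos (show 1 ≤ l from h0)]
          simp only [schurStep]
          rw [show k + 1 - (k + 1 - l) = l by omega]
          field_simp
          ring
      · obtain ⟨l, rfl⟩ : ∃ l, i = k + 2 + l := ⟨i - (k + 2), by omega⟩
        rw [matP_mulVec_rel M x (by omega), matQ_mulVec_zero, xa _ (by omega), xb]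
        field_simp
        ring
  refine ⟨fun j hj => ?_, fun j hj => ?_⟩
  · rw [vStep_eq_of_mulVec_eq hM0 key (by omega), xa j hj]
  · rw [vStep_eq_of_mulVec_eq hM0 key (by omega), xb j]

end LinearStep


/-! ### Values of rational functions -/

section Values

variable {g : ℕ} {p : Option (Fin (g + 1)) → ℝ} {f f' : RatField g} {r r' : ℝ}

/-- The rational function `f` is regular at the point `p`, with value `r`. -/
def HasVal (p : Option (Fin (g + 1)) → ℝ) (f : RatField g) (r : ℝ) : Prop :=
  ∃ a b : Poly g, MvPolynomial.aeval p b ≠ 0 ∧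
    f * algebraMap (Poly g) (RatField g) b = algebraMap (Poly g) (RatField g) a ∧
    MvPolynomial.aeval p a = r * MvPolynomial.aeval p b

lemma hasVal_iff : HasVal p f r ↔ RatDefined f p ∧ ratValue f p = r := by
  have hspec : f * algebraMap (Poly g) (RatField g) (IsFractionRing.den (Poly g) f : Poly g) =
      algebraMap (Poly g) (RatField g) (IsFractionRing.num (Poly g) f) := by
    have h := IsLocalization.mk'_spec (RatField g) (IsFractionRing.num (Poly g) f)
      (IsFractionRing.den (Poly g) f)
    rwa [IsFractionRing.mk'_num_den] at h
  constructor
  · rintro ⟨a, b, hb, hab, hr⟩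
    have h1 : IsFractionRing.num (Poly g) f * b = a * (IsFractionRing.den (Poly g) f : Poly g) := by
      apply IsFractionRing.injective (Poly g) (RatField g)
      rw [map_mul, map_mul, ← hspec, ← hab]
      ring
    have h2 : (IsFractionRing.den (Poly g) f : Poly g) ∣ b :=
      (IsFractionRing.num_den_reduced (Poly g) f).symm.dvd_of_dvd_mul_left
        (h1 ▸ Dvd.intro_left _ rfl)
    have h3 : RatDefined f p := by
      obtain ⟨e, he⟩ := h2
      intro h0
      apply hb
      rw [he, map_mul, h0, zero_mul]
    refine ⟨h3, ?_⟩
    have h4 := congrArg (MvPolynomial.aeval p) h1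
    rw [map_mul, map_mul, hr] at h4
    rw [ratValue, div_eq_iff h3]
    apply mul_right_cancel₀ hb
    rw [h4]; ring
  · rintro ⟨h, rfl⟩
    exact ⟨_, _, h, hspec, (div_mul_cancel₀ _ h).symm⟩

lemma RatDefined.hasVal (h : RatDefined f p) : HasVal p f (ratValue f p) := hasVal_iff.2 ⟨h, rfl⟩

lemma HasVal.ratDefined (h : HasVal p f r) : RatDefined f p := (hasVal_iff.1 h).1

lemma HasVal.ratValue_eq (h : HasVal p f r) : ratValue f p = r := (hasVal_iff.1 h).2

lemma HasVal.unique (h : HasVal p f r) (h' : HasVal p f r') : r = r' :=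
  h.ratValue_eq.symm.trans h'.ratValue_eq

lemma hasVal_algebraMap (p : Option (Fin (g + 1)) → ℝ) (a : Poly g) :
    HasVal p (algebraMap (Poly g) (RatField g) a) (MvPolynomial.aeval p a) :=
  ⟨a, 1, by simp, by simp, by simp⟩

lemma hasVal_zero : HasVal p 0 0 := by simpa using hasVal_algebraMap p 0

lemma hasVal_one : HasVal p 1 1 := by simpa using hasVal_algebraMap p 1

lemma HasVal.add (h : HasVal p f r) (h' : HasVal p f' r') : HasVal p (f + f') (r + r') := by
  obtain ⟨a, b, hb, hab, hr⟩ := h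
  obtain ⟨a', b', hb', hab', hr'⟩ := h'
  refine ⟨a * b' + a' * b, b * b', by simpa using ⟨hb, hb'⟩, ?_, ?_⟩
  · simp only [map_add, map_mul, ← hab, ← hab']; ring
  · simp only [map_add, map_mul, hr, hr']; ring

lemma HasVal.mul (h : HasVal p f r) (h' : HasVal p f' r') : HasVal p (f * f') (r * r') := by
  obtain ⟨a, b, hb, hab, hr⟩ := h
  obtain ⟨a', b', hb', hab', hr'⟩ := h'
  refine ⟨a * a', b * b', by simpa using ⟨hb, hb'⟩, ?_, ?_⟩
  · simp only [map_mul, ← hab, ← hab']; ring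
  · simp only [map_mul, hr, hr']; ring

lemma HasVal.neg (h : HasVal p f r) : HasVal p (-f) (-r) := by
  obtain ⟨a, b, hb, hab, hr⟩ := h
  exact ⟨-a, b, hb, by simp [← hab], by simp [hr]⟩

lemma HasVal.sub (h : HasVal p f r) (h' : HasVal p f' r') : HasVal p (f - f') (r - r') := by
  simpa only [sub_eq_add_neg] using h.add h'.neg

lemma HasVal.ne_zero (h : HasVal p f r) (hr : r ≠ 0) : f ≠ 0 := by
  rintro rfl
  exact hr (h.unique hasVal_zero)

lemma HasVal.inv (h : HasVal p f r) (hr : r ≠ 0) : HasVal p f⁻¹ r⁻¹ := by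
  have hf := h.ne_zero hr
  obtain ⟨a, b, hb, hab, hr'⟩ := h
  refine ⟨b, a, by rw [hr']; exact mul_ne_zero hr hb, ?_, ?_⟩
  · rw [← hab, inv_mul_cancel_left₀ hf]
  · rw [hr', inv_mul_cancel_left₀ hr]

lemma HasVal.div (h : HasVal p f r) (h' : HasVal p f' r') (hr' : r' ≠ 0) :
    HasVal p (f / f') (r / r') := by
  simpa only [div_eq_mul_inv] using h.mul (h'.inv hr')

lemma HasVal.pow (h : HasVal p f r) (n : ℕ) : HasVal p (f ^ n) (r ^ n) := by
  induction n with
  | zero => simpa using hasVal_one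
  | succ n ih => simpa only [pow_succ] using ih.mul h

lemma HasVal.zpow (h : HasVal p f r) (hr : r ≠ 0) (n : ℤ) : HasVal p (f ^ n) (r ^ n) := by
  cases n with
  | ofNat n => simpa using h.pow n
  | negSucc n => simpa only [zpow_negSucc] using (h.pow (n + 1)).inv (pow_ne_zero _ hr)

lemma HasVal.schurStep {N j : ℕ} {s : ℕ → RatField g} {σ : ℕ → ℝ}
    (h : ∀ i ≤ N, HasVal p (s i) (σ i)) (hj : j ≤ N) (h0 : σ 0 - σ N ≠ 0) :
    HasVal p (schurStep N s j) (schurStep N σ j) :=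
  (((h 0 (by omega)).mul (h j hj)).sub ((h N le_rfl).mul (h (N - j) (by omega)))).div
    ((h 0 (by omega)).sub (h N le_rfl)) h0

end Values

/-! ### The vectors `v_g(n)` and the Schur–Cohn recursion -/

section Recursion

variable {F : Type*} [Field F]

/-- The iterates of the Schur–Cohn recursion starting from a vector of length `2g + 1`. -/
def schurSeq (g : ℕ) (s : ℕ → F) : ℕ → ℕ → F
  | 0 => s
  | n + 1 => schurStep (2 * g - n) (schurSeq g s n)

/-- Both factors of `s(0)² - s(N)²` are nonzero for the first `n` iterates. -/
def SchurRegular (g : ℕ) (s : ℕ → F) (n : ℕ) : Prop :=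
  ∀ i < n, schurSeq g s i 0 - schurSeq g s i (2 * g - i) ≠ 0 ∧
    schurSeq g s i 0 + schurSeq g s i (2 * g - i) ≠ 0

lemma SchurRegular.mono {g : ℕ} {s : ℕ → F} {n n' : ℕ} (h : SchurRegular g s n) (hn : n' ≤ n) :
    SchurRegular g s n' := fun i hi => h i (by omega)

lemma vSeq_eq_schurSeq [CharZero F] {g : ℕ} {v s : ℕ → F}
    (ha : ∀ j < 2 * g + 1, v j = s j) (hb : ∀ j < 2 * g + 1, v (2 * g + 1 + j) = s j)
    (hreg : SchurRegular g s (2 * g)) :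
    ∃ M : ℕ → F, M 0 = 1 ∧ (∀ n ≤ 2 * g, M n ≠ 0) ∧
      (∀ n < 2 * g, mSeq g v (n + 1) = M (n + 1)) ∧
      (∀ n < 2 * g, M (n + 1) * (schurSeq g s n 0 - schurSeq g s n (2 * g - n)) =
        M n * (schurSeq g s n 0 + schurSeq g s n (2 * g - n))) ∧
      ∀ n ≤ 2 * g, ∀ j < 2 * g - n + 1, vSeq g v n j = schurSeq g s n j ∧
        vSeq g v n (2 * g - n + 1 + j) = schurSeq g s n j / M n := by
  set M : ℕ → F := fun n => if n = 0 then 1 else mSeq g v n with hM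
  have key : ∀ n ≤ 2 * g, M n ≠ 0 ∧ ∀ j < 2 * g - n + 1, vSeq g v n j = schurSeq g s n j ∧
        vSeq g v n (2 * g - n + 1 + j) = schurSeq g s n j / M n := by
    intro n
    induction n with
    | zero =>
      intro _
      refine ⟨by simp [hM], fun j hj => ⟨ha j (by omega), ?_⟩⟩
      simp only [hM, if_true, div_one, tsub_zero]
      exact hb j (by omega)
    | succ n ih =>
      intro hn
      obtain ⟨ih1, ih2⟩ := ih (by omega)
      obtain ⟨r1, r2⟩ := hreg n (by omega)
      have e : 2 * g - n = 2 * g - (n + 1) + 1 := by omega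
      rw [e] at ih2 r1 r2
      have hm := mStep_of_proportional (k := 2 * g - (n + 1)) (fun j hj => (ih2 j hj).1)
        (fun j hj => (ih2 j hj).2)
      have hv := vStep_of_proportional (k := 2 * g - (n + 1)) ih1 (fun j hj => (ih2 j hj).1)
        (fun j hj => (ih2 j hj).2) r1 r2
      have hMn : M (n + 1) = mStep (2 * g - (n + 1)) (vSeq g v n) := by
        simp [hM, mSeq]
      refine ⟨?_, fun j hj => ?_⟩
      · rw [hMn, hm]
        exact div_ne_zero (mul_ne_zero ih1 r2) r1
      · rw [hMn, vSeq, schurSeq, e]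
        exact ⟨hv.1 j hj, hv.2 j hj⟩
  refine ⟨M, by simp [hM], fun n hn => (key n hn).1, fun n hn => by simp [hM], fun n hn => ?_,
    fun n hn => (key n hn).2⟩
  obtain ⟨ih1, ih2⟩ := key n (by omega)
  obtain ⟨r1, r2⟩ := hreg n hn
  have e : 2 * g - n = 2 * g - (n + 1) + 1 := by omega
  rw [e] at ih2 r1 r2 ⊢
  have hm := mStep_of_proportional (k := 2 * g - (n + 1)) (fun j hj => (ih2 j hj).1)
    (fun j hj => (ih2 j hj).2)
  have hMn : M (n + 1) = mStep (2 * g - (n + 1)) (vSeq g v n) := by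
    simp [hM, mSeq]
  rw [hMn, hm, div_mul_cancel₀ _ r1]

/-- The coefficients of `x^g P_g(X/x)`, i.e. the first half of `v_g(0)`. -/
def initReal {g : ℕ} (c : Fin (g + 1) → ℝ) (x : ℝ) (j : ℕ) : ℝ :=
  c ⟨min j (2 * g - j), by omega⟩ * x ^ ((g : ℤ) - (j : ℤ))

variable {g : ℕ} (c : Fin (g + 1) → ℝ) {x : ℝ}

lemma initReal_zero (x : ℝ) : initReal c x 0 = c 0 * x ^ (g : ℤ) := by
  simp [initReal]

lemma initReal_last (x : ℝ) : initReal c x (2 * g) = c 0 * x ^ (-(g : ℤ)) := by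
  have : (⟨min (2 * g) (2 * g - 2 * g), by omega⟩ : Fin (g + 1)) = 0 := Fin.ext (by simp)
  rw [initReal, this, show (g : ℤ) - ((2 * g : ℕ) : ℤ) = -g by push_cast; ring]

lemma hasVal_initVec (hx : x ≠ 0) {j : ℕ} (hj : j < 2 * g + 1) :
    HasVal (point c x) (initVec g j) (initReal c x j) := by
  simp only [initVec, hj, if_true, initReal]
  refine HasVal.mul ?_ (HasVal.zpow ?_ hx _)
  · simpa [point] using hasVal_algebraMap (point c x)
      (MvPolynomial.X (some ⟨min j (2 * g - j), by omega⟩))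
  · simpa [point] using hasVal_algebraMap (point c x) (MvPolynomial.X none)

lemma hasVal_schurSeq (hx : x ≠ 0) {n : ℕ} (hn : n ≤ 2 * g)
    (h : SchurRegular g (initReal c x) n) :
    ∀ j ≤ 2 * g - n, HasVal (point c x) (schurSeq g (initVec g) n j)
      (schurSeq g (initReal c x) n j) := by
  induction n with
  | zero => exact fun j hj => hasVal_initVec c hx (by omega)
  | succ n ih =>
    intro j hj
    exact HasVal.schurStep (ih (by omega) (h.mono (by omega))) (by omega) (h n (by omega)).1

lemma schurSeq_binomial (hx : 1 < x) (hg : 1 ≤ g) (n : ℕ) (hn : n ≤ 2 * g)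
    (hn1 : 1 ≤ n) :
    schurSeq g (initReal (Pi.single (0 : Fin (g + 1)) (1 : ℝ)) x) n 0 ≠ 0 ∧
      ∀ j, 1 ≤ j → j ≤ 2 * g - n →
        schurSeq g (initReal (Pi.single (0 : Fin (g + 1)) (1 : ℝ)) x) n j = 0 := by
  have h0 : initReal (Pi.single (0 : Fin (g + 1)) (1 : ℝ)) x 0 = x ^ (g : ℤ) := by
    simp [initReal_zero]
  have h2 : initReal (Pi.single (0 : Fin (g + 1)) (1 : ℝ)) x (2 * g) = x ^ (-(g : ℤ)) := by
    simp [initReal_last]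
  have hmid : ∀ j, 1 ≤ j → j < 2 * g →
      initReal (Pi.single (0 : Fin (g + 1)) (1 : ℝ)) x j = 0 := by
    intro j h1 h3
    have : (⟨min j (2 * g - j), by omega⟩ : Fin (g + 1)) ≠ 0 := by
      intro h
      have := congrArg Fin.val h
      simp at this
      omega
    simp [initReal, Pi.single_eq_of_ne this]
  have hlt : x ^ (-(g : ℤ)) < x ^ (g : ℤ) := zpow_lt_zpow_right₀ hx (by omega)
  have hpos : 0 < x ^ (-(g : ℤ)) := zpow_pos (by linarith) _
  induction n, hn1 using Nat.le_induction with
  | base =>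
    simp only [schurSeq, schurStep, tsub_zero, h0, h2]
    refine ⟨div_ne_zero ?_ (by linarith), fun j h1 h3 => ?_⟩
    · nlinarith
    · rw [hmid j h1 (by omega), hmid (2 * g - j) (by omega) (by omega)]
      simp
  | succ n h1 ih =>
    obtain ⟨ih0, ih1⟩ := ih (by omega)
    simp only [schurSeq, schurStep]
    rw [ih1 (2 * g - n) (by omega) le_rfl]
    refine ⟨?_, fun j h2 h3 => ?_⟩
    · simpa using ih0
    · rw [ih1 j h2 (by omega)]; simp

lemma schurRegular_initVec (hg : 1 ≤ g) : SchurRegular g (initVec g) (2 * g) := by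
  have hreg : SchurRegular g (initReal (Pi.single (0 : Fin (g + 1)) (1 : ℝ)) 2) (2 * g) := by
    intro n hn
    rcases Nat.eq_zero_or_pos n with rfl | h
    · simp only [schurSeq, initReal_zero, initReal_last, tsub_zero, Pi.single_eq_same, one_mul]
      have hlt : (2 : ℝ) ^ (-(g : ℤ)) < 2 ^ (g : ℤ) :=
        zpow_lt_zpow_right₀ one_lt_two (by omega)
      have hpos : (0 : ℝ) < 2 ^ (-(g : ℤ)) := zpow_pos two_pos _
      constructor <;> linarith
    · obtain ⟨h0, h1⟩ := schurSeq_binomial one_lt_two hg n hn.le h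
      rw [h1 (2 * g - n) (by omega) le_rfl]
      simpa using h0
  intro n hn
  have hv := hasVal_schurSeq _ two_ne_zero hn.le (hreg.mono hn.le)
  exact ⟨((hv 0 (by omega)).sub (hv _ le_rfl)).ne_zero (hreg n hn).1,
    ((hv 0 (by omega)).add (hv _ le_rfl)).ne_zero (hreg n hn).2⟩

/-- The condition of the Schur–Cohn criterion. -/
def SchurStable (g : ℕ) (s : ℕ → ℝ) : Prop :=
  ∀ n < 2 * g, |schurSeq g s n (2 * g - n)| < |schurSeq g s n 0|

lemma add_div_sub_pos_iff {a b : ℝ} : |b| < |a| ↔ 0 < (a + b) / (a - b) := by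
  rw [← sq_lt_sq, div_pos_iff, ← sub_pos, show a ^ 2 - b ^ 2 = (a + b) * (a - b) by ring,
    mul_pos_iff]

lemma SchurStable.regular {s : ℕ → ℝ} (h : SchurStable g s) : SchurRegular g s (2 * g) := by
  intro n hn
  have := add_div_sub_pos_iff.1 (h n hn)
  constructor <;> intro h0 <;> simp [h0] at this

lemma schurStable_of_ratValue_pos (hg : 1 ≤ g) (hx : x ≠ 0) (hc : c 0 ≠ 0)
    (h : ∀ n ∈ Finset.Icc 1 (2 * g), RatDefined (mRat g n) (point c x) ∧
      0 < ratValue (mRat g n) (point c x)) : SchurStable g (initReal c x) := by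
  obtain ⟨M, hM0, hMne, hmM, hrec, hv⟩ := vSeq_eq_schurSeq (v := initVec g) (s := initVec g)
    (fun j hj => rfl) (fun j hj => by
      simp only [initVec]
      rw [if_neg (by omega), if_pos (by omega), if_pos hj, add_tsub_cancel_left])
    (schurRegular_initVec hg)
  have hMval : ∀ n ≤ 2 * g, ∃ μ : ℝ, 0 < μ ∧ HasVal (point c x) (M n) μ := by
    intro n hn
    rcases Nat.eq_zero_or_pos n with rfl | h0
    · exact ⟨1, one_pos, hM0 ▸ hasVal_one⟩
    · obtain ⟨n, rfl⟩ : ∃ l, n = l + 1 := ⟨n - 1, by omega⟩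
      obtain ⟨h1, h2⟩ := h (n + 1) (by simp; omega)
      refine ⟨_, h2, ?_⟩
      rw [← hmM n (by omega)]
      exact h1.hasVal
  have step : ∀ n < 2 * g, SchurRegular g (initReal c x) n →
      schurSeq g (initReal c x) n 0 ≠ 0 →
      |schurSeq g (initReal c x) n (2 * g - n)| < |schurSeq g (initReal c x) n 0| := by
    intro n hn hr h0
    have hs := hasVal_schurSeq c hx hn.le hr
    obtain ⟨μ, hμ, hμv⟩ := hMval n hn.le
    obtain ⟨μ', hμ', hμv'⟩ := hMval (n + 1) hn
    have e := (hμv'.mul ((hs 0 (by omega)).sub (hs _ le_rfl))).unique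
      (hrec n hn ▸ hμv.mul ((hs 0 (by omega)).add (hs _ le_rfl)))
    generalize schurSeq g (initReal c x) n 0 = a at *
    generalize schurSeq g (initReal c x) n (2 * g - n) = b at *
    have hab : a - b ≠ 0 := by
      intro hab
      rw [hab, mul_zero, eq_comm, mul_eq_zero] at e
      have := e.resolve_left hμ.ne'
      apply h0
      linarith
    rw [add_div_sub_pos_iff]
    have : (a + b) / (a - b) = μ' / μ := by
      rw [div_eq_div_iff hab hμ.ne']; linarith
    rw [this]
    positivity
  have key : ∀ n ≤ 2 * g, SchurRegular g (initReal c x) n ∧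
      schurSeq g (initReal c x) n 0 ≠ 0 := by
    intro n
    induction n with
    | zero =>
      refine fun _ => ⟨fun i hi => absurd hi (by omega), ?_⟩
      simpa [schurSeq, initReal_zero, hx] using hc
    | succ n ih =>
      intro hn
      obtain ⟨ih1, ih2⟩ := ih (by omega)
      have hlt := add_div_sub_pos_iff.1 (step n (by omega) ih1 ih2)
      have hreg : SchurRegular g (initReal c x) (n + 1) := by
        intro i hi
        rcases (Nat.lt_succ_iff_lt_or_eq.1 hi) with hi | rfl
        · exact ih1 i hi
        · constructor <;> intro h0 <;> simp [h0] at hlt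
      refine ⟨hreg, ?_⟩
      obtain ⟨r1, r2⟩ := hreg n (by omega)
      simp only [schurSeq, schurStep, tsub_zero]
      refine div_ne_zero ?_ r1
      convert mul_ne_zero r2 r1 using 1
      ring
  exact fun n hn => step n hn (key n hn.le).1 (key n hn.le).2

lemma SchurStable.values (hg : 1 ≤ g) (hx : x ≠ 0) (h : SchurStable g (initReal c x)) :
    ∃ μ : ℕ → ℝ, (∀ n ≤ 2 * g, 0 < μ n) ∧
      (∀ n < 2 * g, μ (n + 1) = μ n * ((schurSeq g (initReal c x) n 0 +
        schurSeq g (initReal c x) n (2 * g - n)) / (schurSeq g (initReal c x) n 0 -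
        schurSeq g (initReal c x) n (2 * g - n)))) ∧
      (∀ n ∈ Finset.Icc 1 (2 * g), HasVal (point c x) (mRat g n) (μ n)) ∧
      ∀ n ≤ 2 * g, ∀ j < 2 * g - n + 1,
        HasVal (point c x) (vRat g n j) (schurSeq g (initReal c x) n j) ∧
        HasVal (point c x) (vRat g n (2 * g - n + 1 + j))
          (schurSeq g (initReal c x) n j / μ n) := by
  obtain ⟨M, hM0, hMne, hmM, hrec, hv⟩ := vSeq_eq_schurSeq (v := initVec g) (s := initVec g)
    (fun j hj => rfl) (fun j hj => by
      simp only [initVec]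
      rw [if_neg (by omega), if_pos (by omega), if_pos hj, add_tsub_cancel_left])
    (schurRegular_initVec hg)
  have hs := fun n (hn : n ≤ 2 * g) => hasVal_schurSeq c hx hn (h.regular.mono hn)
  have hstep : ∀ n < 2 * g, ∀ μ : ℝ, HasVal (point c x) (M n) μ →
      HasVal (point c x) (M (n + 1)) (μ * ((schurSeq g (initReal c x) n 0 +
        schurSeq g (initReal c x) n (2 * g - n)) / (schurSeq g (initReal c x) n 0 -
        schurSeq g (initReal c x) n (2 * g - n)))) := by
    intro n hn μ hμv
    have e : M (n + 1) = M n * ((schurSeq g (initVec g) n 0 +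
        schurSeq g (initVec g) n (2 * g - n)) / (schurSeq g (initVec g) n 0 -
        schurSeq g (initVec g) n (2 * g - n))) := by
      rw [← mul_div_assoc, ← hrec n hn, mul_div_cancel_right₀]
      exact (schurRegular_initVec hg n hn).1
    rw [e]
    have hs' := hs n hn.le
    exact hμv.mul (((hs' 0 (by omega)).add (hs' _ le_rfl)).div
      ((hs' 0 (by omega)).sub (hs' _ le_rfl)) (h.regular n hn).1)
  have hMval : ∀ n ≤ 2 * g, ∃ μ : ℝ, 0 < μ ∧ HasVal (point c x) (M n) μ := by
    intro n
    induction n with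
    | zero => exact fun _ => ⟨1, one_pos, hM0 ▸ hasVal_one⟩
    | succ n ih =>
      intro hn
      obtain ⟨μ, hμ, hμv⟩ := ih (by omega)
      exact ⟨_, mul_pos hμ (add_div_sub_pos_iff.1 (h n hn)), hstep n hn μ hμv⟩
  choose! μ hμ hμv using hMval
  refine ⟨μ, hμ, fun n hn => (hμv _ hn).unique (hstep n hn _ (hμv n hn.le)), fun n hn => ?_,
    fun n hn j hj => ?_⟩
  · obtain ⟨h1, h2⟩ := Finset.mem_Icc.1 hn
    obtain ⟨n, rfl⟩ : ∃ l, n = l + 1 := ⟨n - 1, by omega⟩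
    rw [mRat, hmM n (by omega)]
    exact hμv _ h2
  · obtain ⟨h1, h2⟩ := hv n hn j hj
    rw [vRat, h1, h2]
    exact ⟨hs n hn j (by omega), (hs n hn j (by omega)).div (hμv n hn) (hμ n hn).ne'⟩

end Recursion


/-! ### The Schur–Cohn criterion -/

section SchurCohn

/-- The polynomial with coefficients `s 0, …, s N` as a function. -/
def polyVal (N : ℕ) (s : ℕ → ℝ) (X : ℂ) : ℂ := ∑ j ∈ Finset.range (N + 1), (s j : ℂ) * X ^ j

/-- No zeros in the closed unit disc. -/
def DiscFree (N : ℕ) (s : ℕ → ℝ) : Prop := ∀ X : ℂ, ‖X‖ ≤ 1 → polyVal N s X ≠ 0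

variable {N : ℕ} {s : ℕ → ℝ}

lemma polyVal_zero (N : ℕ) (s : ℕ → ℝ) : polyVal N s 0 = s 0 := by
  rw [polyVal, Finset.sum_eq_single 0] <;> simp +contextual

lemma differentiable_polyVal (N : ℕ) (s : ℕ → ℝ) : Differentiable ℂ (polyVal N s) := by
  unfold polyVal
  fun_prop

lemma polyVal_reverse_of_ne_zero (N : ℕ) (s : ℕ → ℝ) {X : ℂ} (hX : X ≠ 0) :
    polyVal N (fun j => s (N - j)) X = X ^ N * polyVal N s X⁻¹ := by
  rw [polyVal, polyVal, ← Finset.sum_range_reflect, Finset.mul_sum]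
  refine Finset.sum_congr rfl fun j hj => ?_
  have hj' : j ≤ N := by simpa [Nat.lt_succ_iff] using hj
  rw [show N - (N + 1 - 1 - j) = j by omega, show N + 1 - 1 - j = N - j by omega, inv_pow,
    pow_sub₀ _ hX hj']
  ring

lemma norm_polyVal_reverse_of_norm_eq_one (N : ℕ) (s : ℕ → ℝ) {X : ℂ} (hX : ‖X‖ = 1) :
    ‖polyVal N (fun j => s (N - j)) X‖ = ‖polyVal N s X‖ := by
  have hX0 : X ≠ 0 := by rintro rfl; simp at hX
  have h : polyVal N s X⁻¹ = (starRingEnd ℂ) (polyVal N s X) := by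
    rw [Complex.inv_eq_conj hX]
    simp [polyVal, map_sum]
  rw [polyVal_reverse_of_ne_zero N s hX0, h, norm_mul, norm_pow, hX, one_pow, one_mul,
    RCLike.norm_conj]

lemma DiscFree.norm_reverse_le (h : DiscFree N s) {X : ℂ} (hX : ‖X‖ ≤ 1) :
    ‖polyVal N (fun j => s (N - j)) X‖ ≤ ‖polyVal N s X‖ := by
  have hd : DiffContOnCl ℂ (fun X => polyVal N (fun j => s (N - j)) X / polyVal N s X)
      (Metric.ball 0 1) := by
    apply DifferentiableOn.diffContOnCl
    intro X hX
    rw [closure_ball _ one_ne_zero, mem_closedBall_zero_iff] at hX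
    exact ((differentiable_polyVal _ _).differentiableAt.div
      (differentiable_polyVal _ _).differentiableAt (h X hX)).differentiableWithinAt
  have := Complex.norm_le_of_forall_mem_frontier_norm_le (C := 1) Metric.isBounded_ball hd
    (fun z hz => by
      rw [frontier_ball _ one_ne_zero, mem_sphere_zero_iff_norm] at hz
      rw [norm_div, norm_polyVal_reverse_of_norm_eq_one N s hz,
        div_self (norm_ne_zero_iff.2 (h z hz.le))])
    (z := X) (by rwa [closure_ball _ one_ne_zero, mem_closedBall_zero_iff])
  rwa [norm_div, div_le_one (norm_pos_iff.2 (h X hX))] at this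

lemma one_lt_norm_multiset_prod {m : Multiset ℂ} (hm : ∀ z ∈ m, 1 < ‖z‖) :
    1 ≤ ‖m.prod‖ ∧ (m ≠ 0 → 1 < ‖m.prod‖) := by
  induction m using Multiset.induction_on with
  | empty => simp
  | cons a m ih =>
    have h1 := hm a (by simp)
    have h2 := (ih fun z hz => hm z (by simp [hz])).1
    rw [Multiset.prod_cons, norm_mul]
    have : 1 < ‖a‖ * ‖m.prod‖ := by nlinarith
    exact ⟨this.le, fun _ => this⟩

lemma DiscFree.abs_last_lt (h : DiscFree N s) (hN : N ≠ 0) : |s N| < |s 0| := by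
  have h0 : s 0 ≠ 0 := by
    have := h 0 (by simp)
    rw [polyVal_zero] at this
    exact_mod_cast this
  by_cases hsN : s N = 0
  · simpa [hsN] using h0
  set w : Polynomial ℂ :=
    ∑ j ∈ Finset.range (N + 1), Polynomial.C (s j : ℂ) * Polynomial.X ^ j with hw
  have hcoeff : ∀ i, w.coeff i = if i < N + 1 then (s i : ℂ) else 0 := by
    intro i
    simp [hw, Polynomial.coeff_C_mul, Polynomial.coeff_X_pow]
  have hdeg : w.natDegree = N := by
    apply Polynomial.natDegree_eq_of_le_of_coeff_ne_zero
    · rw [Polynomial.natDegree_le_iff_coeff_eq_zero]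
      intro i hi
      rw [hcoeff, if_neg (by omega)]
    · rw [hcoeff, if_pos (by omega)]
      exact_mod_cast hsN
  have heval : ∀ X, w.eval X = polyVal N s X := by
    intro X
    simp [hw, polyVal, Polynomial.eval_finsetSum]
  have hw0 : w ≠ 0 := by
    rintro h; rw [h] at hdeg; simp at hdeg; omega
  have hroots : ∀ z ∈ w.roots, 1 < ‖z‖ := by
    intro z hz
    by_contra! hz1
    exact h z hz1 (by rw [← heval]; exact (Polynomial.mem_roots hw0).1 hz)
  have hsplit := IsAlgClosed.splits w
  have hne : w.roots ≠ 0 := by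
    intro h1
    have := hsplit.natDegree_eq_card_roots
    rw [h1, hdeg] at this
    simp at this; omega
  have hprod := congrArg norm hsplit.coeff_zero_eq_leadingCoeff_mul_prod_roots
  rw [Polynomial.leadingCoeff, hdeg, hcoeff, hcoeff, if_pos (by omega), if_pos (by omega), norm_mul,
    norm_mul, norm_pow, norm_neg, norm_one, one_pow, one_mul, Complex.norm_real,
    Complex.norm_real, Real.norm_eq_abs, Real.norm_eq_abs] at hprod
  rw [hprod]
  exact lt_mul_of_one_lt_right (abs_pos.2 hsN) ((one_lt_norm_multiset_prod hroots).2 hne)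

lemma schurStep_last (N : ℕ) (s : ℕ → ℝ) : schurStep N s N = 0 := by
  simp [schurStep, mul_comm]

lemma sub_mul_polyVal_schurStep (N : ℕ) (s : ℕ → ℝ) (h : s 0 - s (N + 1) ≠ 0) (X : ℂ) :
    ((s 0 : ℂ) - s (N + 1)) * polyVal N (schurStep (N + 1) s) X =
      s 0 * polyVal (N + 1) s X - s (N + 1) * polyVal (N + 1) (fun j => s (N + 1 - j)) X := by
  have h' : (s 0 : ℂ) - s (N + 1) ≠ 0 := by exact_mod_cast h
  have e : polyVal N (schurStep (N + 1) s) X = polyVal (N + 1) (schurStep (N + 1) s) X := by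
    rw [polyVal, polyVal, Finset.sum_range_succ _ (N + 1), schurStep_last]
    simp
  rw [e, polyVal, polyVal, polyVal, Finset.mul_sum, Finset.mul_sum, Finset.mul_sum,
    ← Finset.sum_sub_distrib]
  refine Finset.sum_congr rfl fun j _ => ?_
  simp only [schurStep]
  push_cast
  field_simp

lemma mul_sub_mul_ne_zero {a b : ℝ} {w v : ℂ} (hab : |b| < |a|) (hw : w ≠ 0) (hv : ‖v‖ ≤ ‖w‖) :
    (a : ℂ) * w - b * v ≠ 0 := by
  intro h
  have h1 := congrArg norm (sub_eq_zero.1 h)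
  rw [norm_mul, norm_mul, Complex.norm_real, Complex.norm_real, Real.norm_eq_abs,
    Real.norm_eq_abs] at h1
  have h2 : |b| * ‖v‖ ≤ |b| * ‖w‖ := mul_le_mul_of_nonneg_left hv (abs_nonneg _)
  have h3 : |b| * ‖w‖ < |a| * ‖w‖ := mul_lt_mul_of_pos_right hab (norm_pos_iff.2 hw)
  linarith

lemma sub_ne_zero_of_abs_lt {a b : ℝ} (h : |b| < |a|) : a - b ≠ 0 := by
  intro h0
  rw [sub_eq_zero.1 h0] at h
  exact lt_irrefl _ h

lemma DiscFree.schurStep (h : DiscFree (N + 1) s) : DiscFree N (schurStep (N + 1) s) := by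
  intro X hX h0
  have hlt := h.abs_last_lt (by omega)
  have e := sub_mul_polyVal_schurStep N s (sub_ne_zero_of_abs_lt hlt) X
  rw [h0, mul_zero] at e
  exact mul_sub_mul_ne_zero hlt (h X hX) (h.norm_reverse_le hX) e.symm

lemma DiscFree.of_schurStep (h : DiscFree N (SelfReciprocal.schurStep (N + 1) s))
    (hlt : |s (N + 1)| < |s 0|) : DiscFree (N + 1) s := by
  have hne := sub_ne_zero_of_abs_lt hlt
  have hne' : (s 0 : ℂ) - s (N + 1) ≠ 0 := by exact_mod_cast hne
  set t := SelfReciprocal.schurStep (N + 1) s with ht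
  have ht' : DiscFree (N + 1) t := by
    intro X hX
    rw [polyVal, Finset.sum_range_succ, ht, schurStep_last]
    simpa [polyVal, ht] using h X hX
  intro X hX h0
  have e : (s 0 : ℂ) * polyVal (N + 1) t X
      - (-s (N + 1) : ℝ) * polyVal (N + 1) (fun j => t (N + 1 - j)) X =
      (s 0 + s (N + 1)) * polyVal (N + 1) s X := by
    rw [polyVal, polyVal, polyVal, Finset.mul_sum, Finset.mul_sum, Finset.mul_sum,
      ← Finset.sum_sub_distrib]
    refine Finset.sum_congr rfl fun j hj => ?_
    have hj' : j ≤ N + 1 := by simpa [Nat.lt_succ_iff] using hj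
    simp only [ht, SelfReciprocal.schurStep, show N + 1 - (N + 1 - j) = j by omega]
    push_cast
    field_simp
    ring
  rw [h0, mul_zero] at e
  exact mul_sub_mul_ne_zero (by rwa [abs_neg]) (ht' X hX) (ht'.norm_reverse_le hX) e

lemma polyVal_one_schurStep (h : s 0 - s (N + 1) ≠ 0) :
    polyVal N (schurStep (N + 1) s) 1 = polyVal (N + 1) s 1 := by
  have h' : (s 0 : ℂ) - s (N + 1) ≠ 0 := by exact_mod_cast h
  apply mul_left_cancel₀ h'
  have e := polyVal_reverse_of_ne_zero (N + 1) s one_ne_zero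
  rw [inv_one, one_pow, one_mul] at e
  rw [sub_mul_polyVal_schurStep N s h, e]
  ring

variable {g : ℕ}

lemma schurStable_iff_discFree (h0 : s 0 ≠ 0) : SchurStable g s ↔ DiscFree (2 * g) s := by
  have hstep : ∀ n < 2 * g, schurSeq g s (n + 1) =
      schurStep (2 * g - (n + 1) + 1) (schurSeq g s n) := by
    intro n hn
    rw [schurSeq, show 2 * g - (n + 1) + 1 = 2 * g - n by omega]
  constructor
  · intro h
    have hne : ∀ n ≤ 2 * g, schurSeq g s n 0 ≠ 0 := by
      intro n hn
      rcases hn.lt_or_eq with hn | rfl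
      · exact abs_pos.1 ((abs_nonneg _).trans_lt (h n hn))
      · rcases Nat.eq_zero_or_pos g with rfl | hg
        · simpa [schurSeq] using h0
        · obtain ⟨l, hl⟩ : ∃ l, 2 * g = l + 1 := ⟨2 * g - 1, by omega⟩
          have hlt := h l (by omega)
          obtain ⟨r1, r2⟩ := h.regular l (by omega)
          rw [hl, schurSeq, schurStep, tsub_zero]
          refine div_ne_zero ?_ r1
          convert mul_ne_zero r2 r1 using 1
          ring
    have key : ∀ n ≤ 2 * g, DiscFree (2 * g - n) (schurSeq g s n) := by
      intro n hn
      induction hn using Nat.decreasingInduction with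
      | self =>
        intro X _
        simpa [polyVal] using hne (2 * g) le_rfl
      | of_succ n hn ih =>
        rw [hstep n hn] at ih
        have := ih.of_schurStep (by rw [show 2 * g - (n + 1) + 1 = 2 * g - n by omega]; exact h n hn)
        rwa [show 2 * g - (n + 1) + 1 = 2 * g - n by omega] at this
    exact key 0 (by omega)
  · intro h
    have key : ∀ n ≤ 2 * g, DiscFree (2 * g - n) (schurSeq g s n) := by
      intro n
      induction n with
      | zero => exact fun _ => h
      | succ n ih =>
        intro hn
        have := ih (by omega)
        rw [show 2 * g - n = 2 * g - (n + 1) + 1 by omega] at this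
        rw [hstep n (by omega)]
        exact this.schurStep
    exact fun n hn => (key n hn.le).abs_last_lt (by omega)

lemma SchurStable.polyVal_one (h : SchurStable g s) {n : ℕ} (hn : n ≤ 2 * g) :
    polyVal (2 * g - n) (schurSeq g s n) 1 = polyVal (2 * g) s 1 := by
  induction n with
  | zero => rfl
  | succ n ih =>
    have e : 2 * g - n = 2 * g - (n + 1) + 1 := by omega
    have hr := (h.regular n (by omega)).1
    rw [← ih (by omega), schurSeq, e, polyVal_one_schurStep]
    rwa [← e]

end SchurCohn

/-! ### The polynomial `P_g` -/

section PolyP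

variable {g : ℕ} (c : Fin (g + 1) → ℝ)

lemma aeval_polyP (X : ℂ) : Polynomial.aeval X (polyP c) =
    ∑ j ∈ Finset.range (2 * g + 1), (initReal c 1 j : ℂ) * X ^ j := by
  have h1 : ∀ k : Fin g, initReal c 1 k = c k.castSucc := by
    intro k
    have : (⟨min (k : ℕ) (2 * g - k), by omega⟩ : Fin (g + 1)) = k.castSucc :=
      Fin.ext (by simp; omega)
    simp [initReal, this]
  have h2 : ∀ k : Fin g, initReal c 1 (2 * g - k) = c k.castSucc := by
    intro k
    have : (⟨min (2 * g - (k : ℕ)) (2 * g - (2 * g - k)), by omega⟩ : Fin (g + 1)) = k.castSucc :=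
      Fin.ext (by simp; omega)
    simp [initReal, this]
  have h3 : initReal c 1 g = c (Fin.last g) := by
    have : (⟨min g (2 * g - g), by omega⟩ : Fin (g + 1)) = Fin.last g :=
      Fin.ext (by simp; omega)
    simp [initReal, this]
  have h4 : ∑ j ∈ Finset.range g, (initReal c 1 (g + 1 + j) : ℂ) * X ^ (g + 1 + j) =
      ∑ j ∈ Finset.range g, (initReal c 1 (2 * g - j) : ℂ) * X ^ (2 * g - j) := by
    rw [← Finset.sum_range_reflect]
    refine Finset.sum_congr rfl fun j hj => ?_
    have := Finset.mem_range.1 hj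
    rw [show g + 1 + (g - 1 - j) = 2 * g - j by omega]
  rw [show 2 * g + 1 = g + 1 + g by ring, Finset.sum_range_add, Finset.sum_range_succ, h3, h4,
    ← Fin.sum_univ_eq_sum_range (fun j => (initReal c 1 j : ℂ) * X ^ j),
    ← Fin.sum_univ_eq_sum_range (fun j => (initReal c 1 (2 * g - j) : ℂ) * X ^ (2 * g - j))]
  simp only [h1, h2, polyP, map_add, map_sum, map_mul, Polynomial.aeval_C, map_pow,
    Polynomial.aeval_X, Complex.coe_algebraMap, mul_add, Finset.sum_add_distrib]
  ring

lemma polyVal_initReal {x : ℝ} (hx : x ≠ 0) (X : ℂ) :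
    polyVal (2 * g) (initReal c x) X =
      (x : ℂ) ^ g * Polynomial.aeval (X / x) (polyP c) := by
  have hx' : (x : ℂ) ≠ 0 := by exact_mod_cast hx
  rw [aeval_polyP, polyVal, Finset.mul_sum]
  refine Finset.sum_congr rfl fun j _ => ?_
  simp only [initReal, one_zpow, mul_one]
  push_cast
  rw [zpow_sub₀ hx', zpow_natCast, zpow_natCast, div_pow]
  field_simp

lemma aeval_inv_polyP {X : ℂ} (hX : X ≠ 0) :
    Polynomial.aeval X⁻¹ (polyP c) * X ^ (2 * g) = Polynomial.aeval X (polyP c) := by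
  have h := polyVal_reverse_of_ne_zero (2 * g) (initReal c 1) hX
  rw [aeval_polyP, aeval_polyP, mul_comm]
  refine h.symm.trans (Finset.sum_congr rfl fun j hj => ?_)
  have hj' : j ≤ 2 * g := by simpa [Nat.lt_succ_iff] using hj
  have : min (2 * g - j) (2 * g - (2 * g - j)) = min j (2 * g - j) := by omega
  simp [initReal, this]

lemma discFree_initReal_iff {x : ℝ} (hx : 0 < x) :
    DiscFree (2 * g) (initReal c x) ↔
      ∀ X : ℂ, Polynomial.aeval X (polyP c) = 0 → x⁻¹ < ‖X‖ := by
  have hx' : (x : ℂ) ≠ 0 := by exact_mod_cast hx.ne'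
  constructor
  · intro h X hX
    by_contra! hlt
    refine h (X * x) ?_ ?_
    · rw [norm_mul, Complex.norm_real, Real.norm_eq_abs, abs_of_pos hx]
      calc ‖X‖ * x ≤ x⁻¹ * x := mul_le_mul_of_nonneg_right hlt hx.le
        _ = 1 := inv_mul_cancel₀ hx.ne'
    · rw [polyVal_initReal c hx.ne', mul_div_cancel_right₀ _ hx', hX, mul_zero]
  · intro h X hX h0
    rw [polyVal_initReal c hx.ne', mul_eq_zero] at h0
    have h1 := h _ (h0.resolve_left (pow_ne_zero _ hx'))
    rw [norm_div, Complex.norm_real, Real.norm_eq_abs, abs_of_pos hx, inv_eq_one_div,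
      div_lt_div_iff_of_pos_right hx] at h1
    linarith

lemma forall_discFree_iff {q : ℝ} (hq : 1 < q) :
    (∀ ω : ℝ, 0 < ω → DiscFree (2 * g) (initReal c (q ^ ω))) ↔
      ∀ X : ℂ, Polynomial.aeval X (polyP c) = 0 → ‖X‖ = 1 := by
  have hq0 : 0 < q := by linarith
  have hpos : ∀ ω : ℝ, 0 < q ^ ω := fun ω => Real.rpow_pos_of_pos hq0 ω
  constructor
  · intro h
    have hge : ∀ X : ℂ, Polynomial.aeval X (polyP c) = 0 → 1 ≤ ‖X‖ := by
      intro X hX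
      have hlim : Tendsto (fun ω : ℝ => (q ^ ω)⁻¹) (𝓝[>] 0) (𝓝 1) := by
        have : ContinuousAt (fun ω : ℝ => (q ^ ω)⁻¹) 0 :=
          (Real.continuousAt_const_rpow hq0.ne').inv₀ (hpos 0).ne'
        have := this.tendsto
        simp only [Real.rpow_zero, inv_one] at this
        exact this.mono_left nhdsWithin_le_nhds
      refine le_of_tendsto hlim ?_
      filter_upwards [self_mem_nhdsWithin] with ω hω
      exact ((discFree_initReal_iff c (hpos ω)).1 (h ω hω) X hX).le
    intro X hX
    have h1 := hge X hX
    have hX0 : X ≠ 0 := by rintro rfl; simp at h1; linarith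
    have h2 := hge X⁻¹ (by
      have := aeval_inv_polyP c hX0
      rw [hX, mul_eq_zero] at this
      exact this.resolve_right (pow_ne_zero _ hX0))
    rw [norm_inv] at h2
    exact le_antisymm ((one_le_inv₀ (by linarith)).1 h2) h1
  · intro h ω hω
    rw [discFree_initReal_iff c (hpos ω)]
    intro X hX
    rw [h X hX]
    exact inv_lt_one_of_one_lt₀ (Real.one_lt_rpow hq hω)

lemma Eqω_zero {q : ℝ} (hq : 0 < q) (ω : ℝ) :
    Eqω c q ω 0 = polyVal (2 * g) (initReal c (q ^ ω)) 1 := by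
  have hx := Real.rpow_pos_of_pos hq ω
  rw [polyVal_initReal c hx.ne', Eqω, Aq]
  have e1 : -(g : ℂ) * Complex.I * (0 + Complex.I * ω) = (ω : ℂ) * (g : ℂ) := by
    linear_combination (-(g : ℂ) * ω) * Complex.I_mul_I
  have e2 : Complex.I * (0 + Complex.I * ω) = ((-ω : ℝ) : ℂ) := by
    push_cast
    linear_combination (ω : ℂ) * Complex.I_mul_I
  have hq' : (q : ℂ) ≠ 0 := by exact_mod_cast hq.ne'
  rw [e1, e2, Complex.cpow_mul_nat, ← Complex.ofReal_cpow hq.le, ← Complex.ofReal_cpow hq.le,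
    Real.rpow_neg hq.le, one_div, Complex.ofReal_inv]

end PolyP


/-! ### The pieces of the interval -/

section Pieces

variable {q : ℝ} {g : ℕ}

/-- The matrix `diag(m⁻¹, m)`. -/
def diagHam (m : ℝ) : Matrix (Fin 2) (Fin 2) ℝ := !![m⁻¹, 0; 0, m]

lemma rpow_two_mul_div_two (q : ℝ) (g : ℕ) : q ^ (((2 * g : ℕ) : ℝ) / 2) = q ^ g := by
  rw [← Real.rpow_natCast]
  congr 1
  push_cast
  ring

lemma piece_succ (q : ℝ) (n : ℕ) :
    piece q (n + 1) = Set.Ico (q ^ ((n : ℝ) / 2)) (q ^ (((n + 1 : ℕ) : ℝ) / 2)) := by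
  simp [piece]

lemma rpow_half_mono (hq : 1 < q) {n n' : ℕ} (h : n ≤ n') :
    q ^ ((n : ℝ) / 2) ≤ q ^ ((n' : ℝ) / 2) := by
  have : (n : ℝ) ≤ n' := by exact_mod_cast h
  exact Real.rpow_le_rpow_of_exponent_le hq.le (by linarith)

lemma rpow_half_lt_succ (hq : 1 < q) (n : ℕ) :
    q ^ ((n : ℝ) / 2) < q ^ (((n + 1 : ℕ) : ℝ) / 2) :=
  Real.rpow_lt_rpow_of_exponent_lt hq (by push_cast; linarith)

lemma one_le_rpow_half (hq : 1 < q) (n : ℕ) : 1 ≤ q ^ ((n : ℝ) / 2) :=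
  Real.one_le_rpow hq.le (by positivity)

lemma piece_unique (hq : 1 < q) {n n' : ℕ} (h1 : 1 ≤ n) (h1' : 1 ≤ n') {a : ℝ}
    (h : a ∈ piece q n) (h' : a ∈ piece q n') : n = n' := by
  obtain ⟨n, rfl⟩ : ∃ l, n = l + 1 := ⟨n - 1, by omega⟩
  obtain ⟨n', rfl⟩ : ∃ l, n' = l + 1 := ⟨n' - 1, by omega⟩
  rw [piece_succ] at h h'
  by_contra hne
  rcases lt_or_gt_of_ne hne with hlt | hlt
  · exact absurd ((rpow_half_mono hq (show n + 1 ≤ n' by omega)).trans h'.1) (not_le.2 h.2)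
  · exact absurd ((rpow_half_mono hq (show n' + 1 ≤ n by omega)).trans h.1) (not_le.2 h'.2)

lemma exists_mem_piece {a : ℝ} (ha : a ∈ Set.Ico 1 (q ^ g)) :
    ∃ n ∈ Finset.Icc 1 (2 * g), a ∈ piece q n := by
  classical
  have hex : ∃ n : ℕ, a < q ^ ((n : ℝ) / 2) := ⟨2 * g, by rw [rpow_two_mul_div_two]; exact ha.2⟩
  have h1 : 1 ≤ Nat.find hex := by
    rw [Nat.one_le_iff_ne_zero]
    intro h0
    have := Nat.find_spec hex
    rw [h0] at this
    simp only [Nat.cast_zero, zero_div, Real.rpow_zero] at this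
    exact absurd ha.1 (not_le.2 this)
  have h2 : Nat.find hex ≤ 2 * g := Nat.find_min' hex (by rw [rpow_two_mul_div_two]; exact ha.2)
  refine ⟨Nat.find hex, Finset.mem_Icc.2 ⟨h1, h2⟩, ?_, Nat.find_spec hex⟩
  have := Nat.find_min hex (m := Nat.find hex - 1) (by omega)
  rw [Nat.cast_sub h1, not_lt] at this
  simpa using this

lemma piece_subset (hq : 1 < q) {n : ℕ} (hn : n ∈ Finset.Icc 1 (2 * g)) :
    piece q n ⊆ Set.Ico 1 (q ^ g) := by
  obtain ⟨h1, h2⟩ := Finset.mem_Icc.1 hn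
  obtain ⟨n, rfl⟩ : ∃ l, n = l + 1 := ⟨n - 1, by omega⟩
  rw [piece_succ, ← rpow_two_mul_div_two]
  exact Set.Ico_subset_Ico (one_le_rpow_half hq n) (rpow_half_mono hq h2)

lemma sum_indicator_piece {M : Type*} [AddCommMonoid M] (hq : 1 < q) {n : ℕ}
    (hn : n ∈ Finset.Icc 1 (2 * g)) (f : ℕ → ℝ → M) {a : ℝ} (ha : a ∈ piece q n) :
    ∑ l ∈ Finset.Icc 1 (2 * g), (piece q l).indicator (f l) a = f n a := by
  rw [Finset.sum_eq_single n]
  · exact Set.indicator_of_mem ha _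
  · intro l hl hne
    refine Set.indicator_of_notMem (fun h => hne ?_) _
    exact piece_unique hq (Finset.mem_Icc.1 hl).1 (Finset.mem_Icc.1 hn).1 h ha
  · exact fun h => absurd hn h

end Pieces

/-! ### Canonical systems with piecewise constant diagonal Hamiltonians -/

section Glue

variable {q : ℝ} {g : ℕ} {μ : ℕ → ℝ} {H : ℝ → Matrix (Fin 2) (Fin 2) ℝ}

lemma posSemidef_diagHam_iff {m : ℝ} (hm : m ≠ 0) : (diagHam m).PosSemidef ↔ 0 < m := by
  constructor
  · intro h
    have := h.diag_nonneg (i := 1)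
    simp [diagHam] at this
    exact lt_of_le_of_ne this hm.symm
  · intro h
    have : diagHam m = Matrix.diagonal ![m⁻¹, m] := by
      ext i j; fin_cases i <;> fin_cases j <;> simp [diagHam]
    rw [this, Matrix.posSemidef_diagonal_iff]
    intro i
    fin_cases i <;> simp [h.le]

lemma isCanonicalSystem_of_pieces (hg : 1 ≤ g) (hq : 1 < q)
    (hμ : ∀ n ∈ Finset.Icc 1 (2 * g), 0 < μ n)
    (hH : ∀ n ∈ Finset.Icc 1 (2 * g), ∀ a ∈ piece q n, H a = diagHam (μ n))
    {D : Set ℝ} (hD : Set.Ico 1 (q ^ g) ⊆ D) : IsCanonicalSystem 1 (q ^ g) D H where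
  lt := one_lt_pow₀ hq (by omega)
  defined := by
    filter_upwards [ae_restrict_mem measurableSet_Ico] with a ha using hD ha
  posSemidef := by
    filter_upwards [ae_restrict_mem measurableSet_Ico] with a ha
    obtain ⟨n, hn, han⟩ := exists_mem_piece ha
    rw [hH n hn a han]
    exact (posSemidef_diagHam_iff (hμ n hn).ne').2 (hμ n hn)
  nonvanishing := by
    intro U hU hpos hae
    have hne : ∀ᵐ a ∂(volume.restrict (U ∩ Set.Ico 1 (q ^ g))), H a ≠ 0 := by
      filter_upwards [ae_restrict_mem (hU.measurableSet.inter measurableSet_Ico)] with a ha h0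
      obtain ⟨n, hn, han⟩ := exists_mem_piece ha.2
      rw [hH n hn a han] at h0
      have := congrFun (congrFun h0 1) 1
      simp only [diagHam, Matrix.of_apply, Matrix.cons_val', Matrix.cons_val_one,
        Matrix.cons_val_fin_one, Matrix.zero_apply] at this
      exact (hμ n hn).ne' this
    have hfalse : ∀ᵐ a ∂(volume.restrict (U ∩ Set.Ico 1 (q ^ g))), False := by
      filter_upwards [hae, hne] with a h1 h2 using h2 h1
    rw [eventually_false_iff_eq_bot, ae_eq_bot, Measure.restrict_eq_zero] at hfalse
    exact hpos.ne' hfalse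
  locallyIntegrable := by
    intro i j
    have hint : Integrable (∑ n ∈ Finset.Icc 1 (2 * g),
        (piece q n).indicator (fun _ : ℝ => diagHam (μ n) i j)) volume := by
      refine integrable_finsetSum' _ fun n _ => ?_
      exact (integrableOn_const (by simp [piece])).integrable_indicator
        (show MeasurableSet (piece q n) from measurableSet_Ico)
    refine (IntegrableOn.congr_fun hint.integrableOn (fun a ha => ?_)
      measurableSet_Ico).locallyIntegrableOn
    obtain ⟨n, hn, han⟩ := exists_mem_piece ha
    rw [hH n hn a han]
    rw [Finset.sum_apply]
    exact sum_indicator_piece hq hn (fun n _ => diagHam (μ n) i j) han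

/-- The right-hand side of the canonical system, solved for the derivative. -/
def canonicalField (H : Matrix (Fin 2) (Fin 2) ℝ) (z : ℂ) (a : ℝ) (y : Fin 2 → ℂ) : Fin 2 → ℂ :=
  -(a : ℂ)⁻¹ • z • ((!![0, -1; 1, 0] : Matrix (Fin 2) (Fin 2) ℂ) *
    H.map Complex.ofReal).mulVec y

lemma canonicalField_diagHam (m : ℝ) (z : ℂ) (a : ℝ) (y : Fin 2 → ℂ) :
    canonicalField (diagHam m) z a y =
      ![(a : ℂ)⁻¹ * (z * (m * y 1)), -(a : ℂ)⁻¹ * (z * ((m : ℂ)⁻¹ * y 0))] := by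
  ext i
  fin_cases i <;>
    simp [canonicalField, diagHam, Matrix.vecMul, dotProduct, Fin.sum_univ_two]

lemma norm_canonicalField_diagHam_le {m K : ℝ} (hm : 0 < m) (h1 : m ≤ K) (h2 : m⁻¹ ≤ K) (z : ℂ)
    {a : ℝ} (ha : 1 ≤ a) (y : Fin 2 → ℂ) :
    ‖canonicalField (diagHam m) z a y‖ ≤ ‖z‖ * (K * ‖y‖) := by
  have hK : 0 ≤ K := hm.le.trans h1
  have ha1 : a⁻¹ ≤ 1 := inv_le_one_of_one_le₀ ha
  have ha0 : 0 ≤ a⁻¹ := by positivity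
  rw [canonicalField_diagHam, pi_norm_le_iff_of_nonneg (by positivity)]
  intro i
  have hy := norm_le_pi_norm y
  have key : ∀ t w : ℝ, 0 ≤ t → t ≤ K → 0 ≤ w → w ≤ ‖y‖ → a⁻¹ * (‖z‖ * (t * w)) ≤
      ‖z‖ * (K * ‖y‖) := by
    intro t w ht htK hw hwy
    have h3 : t * w ≤ K * ‖y‖ := mul_le_mul htK hwy hw hK
    have h4 : ‖z‖ * (t * w) ≤ ‖z‖ * (K * ‖y‖) := mul_le_mul_of_nonneg_left h3 (norm_nonneg _)
    exact (mul_le_of_le_one_left (by positivity) ha1).trans h4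
  fin_cases i
  · simpa [abs_of_pos hm, abs_of_nonneg (zero_le_one.trans ha)] using
      key m ‖y 1‖ hm.le h1 (norm_nonneg _) (hy 1)
  · simpa [abs_of_pos hm, abs_of_nonneg (zero_le_one.trans ha)] using
      key m⁻¹ ‖y 0‖ (by positivity) h2 (norm_nonneg _) (hy 0)

lemma isCanonicalSolution_of_pieces (hg : 1 ≤ g) (hq : 1 < q)
    (hμ : ∀ n ∈ Finset.Icc 1 (2 * g), 0 < μ n)
    (hH : ∀ n ∈ Finset.Icc 1 (2 * g), ∀ a ∈ piece q n, H a = diagHam (μ n))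
    {Y : ℝ → ℂ → Fin 2 → ℂ} {y : ℕ → ℂ → ℝ → Fin 2 → ℂ}
    (hY : ∀ n ∈ Finset.Icc 1 (2 * g), ∀ a ∈ piece q n, ∀ z, Y a z = y n z a)
    (hder : ∀ n ∈ Finset.Icc 1 (2 * g), ∀ z, ∀ a : ℝ, 0 < a →
      HasDerivAt (y n z) (canonicalField (diagHam (μ n)) z a (y n z a)) a)
    (hglue : ∀ n ∈ Finset.Ico 1 (2 * g), ∀ z,
      y n z (q ^ ((n : ℝ) / 2)) = y (n + 1) z (q ^ ((n : ℝ) / 2)))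
    (hend : ∀ z, y (2 * g) z (q ^ g) = ![1, 0]) : IsCanonicalSolution 1 (q ^ g) H Y := by
  intro z
  have hYclosed : ∀ n, n + 1 ≤ 2 * g → ∀ a < q ^ g, a ∈ Set.Icc (q ^ ((n : ℝ) / 2))
      (q ^ (((n + 1 : ℕ) : ℝ) / 2)) → Y a z = y (n + 1) z a := by
    intro n hn a hag ha
    rcases ha.2.lt_or_eq with hlt | heq
    · exact hY (n + 1) (Finset.mem_Icc.2 ⟨by omega, hn⟩) a (by rw [piece_succ]; exact ⟨ha.1, hlt⟩) z
    · have hn2 : n + 1 ≠ 2 * g := by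
        intro h
        rw [h, rpow_two_mul_div_two] at heq
        exact hag.ne heq
      rw [hY (n + 1 + 1) (Finset.mem_Icc.2 ⟨by omega, by omega⟩) a
        (by rw [piece_succ, heq]; exact ⟨le_rfl, rpow_half_lt_succ hq (n + 1)⟩), heq,
        hglue (n + 1) (Finset.mem_Ico.2 ⟨by omega, by omega⟩)]
  have hpos : ∀ n : ℕ, 0 < q ^ ((n : ℝ) / 2) := fun n => zero_lt_one.trans_le (one_le_rpow_half hq n)
  have hcont : ∀ b < q ^ g, ContinuousOn (fun a => Y a z) (Set.Icc 1 b) := by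
    intro b hb
    have hpiece : ∀ n, n + 1 ≤ 2 * g → ContinuousOn (fun a => Y a z)
        (Set.Icc (q ^ ((n : ℝ) / 2)) (q ^ (((n + 1 : ℕ) : ℝ) / 2)) ∩ Set.Iic b) := by
      intro n hn
      have h1 : ContinuousOn (y (n + 1) z)
          (Set.Icc (q ^ ((n : ℝ) / 2)) (q ^ (((n + 1 : ℕ) : ℝ) / 2)) ∩ Set.Iic b) := by
        intro a ha
        exact (hder (n + 1) (Finset.mem_Icc.2 ⟨by omega, hn⟩) z a
          ((hpos n).trans_le ha.1.1)).continuousAt.continuousWithinAt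
      exact h1.congr fun a ha => hYclosed n hn a (lt_of_le_of_lt ha.2 hb) ha.1
    have hall : ∀ n, n + 1 ≤ 2 * g → ContinuousOn (fun a => Y a z)
        (Set.Icc 1 (q ^ (((n + 1 : ℕ) : ℝ) / 2)) ∩ Set.Iic b) := by
      intro n
      induction n with
      | zero => simpa using hpiece 0
      | succ n ih =>
        intro hn
        have h1 := (ih (by omega)).union_of_isClosed (hpiece (n + 1) hn)
          (isClosed_Icc.inter isClosed_Iic) (isClosed_Icc.inter isClosed_Iic)
        rwa [← Set.union_inter_distrib_right, Set.Icc_union_Icc_eq_Icc (one_le_rpow_half hq _)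
          (rpow_half_lt_succ hq _).le] at h1
    have h2 := hall (2 * g - 1) (by omega)
    rw [show 2 * g - 1 + 1 = 2 * g by omega, rpow_two_mul_div_two] at h2
    exact h2.mono fun a ha => ⟨⟨ha.1, ha.2.trans hb.le⟩, ha.2⟩
  refine ⟨?_, ?_, ?_⟩
  · intro b hb
    obtain ⟨K, hK⟩ : ∃ K, ∀ n ∈ Finset.Icc 1 (2 * g), μ n ≤ K ∧ (μ n)⁻¹ ≤ K := by
      refine ⟨∑ n ∈ Finset.Icc 1 (2 * g), (μ n + (μ n)⁻¹), fun n hn => ?_⟩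
      have hp : ∀ n ∈ Finset.Icc 1 (2 * g), 0 < (μ n)⁻¹ := fun n hn => inv_pos.2 (hμ n hn)
      have : μ n + (μ n)⁻¹ ≤ _ := Finset.single_le_sum (f := fun n => μ n + (μ n)⁻¹)
        (fun n hn => add_nonneg (hμ n hn).le (hp n hn).le) hn
      have h1 := hμ n hn
      have h2 := hp n hn
      constructor <;> linarith
    obtain ⟨B, hB⟩ := isCompact_Icc.exists_bound_of_continuousOn (hcont b hb.2)
    have hK0 : 0 ≤ K := (hμ 1 (Finset.mem_Icc.2 ⟨le_rfl, by omega⟩)).le.trans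
      (hK 1 (Finset.mem_Icc.2 ⟨le_rfl, by omega⟩)).1
    have hB0 : 0 ≤ B := (norm_nonneg _).trans (hB 1 ⟨le_rfl, hb.1⟩)
    have hright : ∀ a ∈ Set.Ico 1 b,
        HasDerivWithinAt (fun a => Y a z) (canonicalField (H a) z a (Y a z)) (Set.Ici a) a := by
      intro a ha
      obtain ⟨n, hn, han⟩ := exists_mem_piece (g := g) ⟨ha.1, ha.2.trans hb.2⟩
      rw [hH n hn a han, hY n hn a han z]
      refine (hder n hn z a (by linarith [ha.1])).hasDerivWithinAt.congr_of_eventuallyEq ?_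
        (hY n hn a han z)
      filter_upwards [Ico_mem_nhdsGE han.2] with t ht
      exact hY n hn t ⟨han.1.trans ht.1, ht.2⟩ z
    have hbound : ∀ a ∈ Set.Ico 1 b, ‖canonicalField (H a) z a (Y a z)‖ ≤ ‖z‖ * (K * B) := by
      intro a ha
      obtain ⟨n, hn, han⟩ := exists_mem_piece (g := g) ⟨ha.1, ha.2.trans hb.2⟩
      rw [hH n hn a han]
      refine (norm_canonicalField_diagHam_le (hμ n hn) (hK n hn).1 (hK n hn).2 z ha.1 _).trans ?_
      have := hB a ⟨ha.1, ha.2.le⟩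
      gcongr
    have hmain : ∀ s ∈ Set.Icc 1 b, ∀ t ∈ Set.Icc 1 b, s ≤ t →
        ‖Y t z - Y s z‖ ≤ ‖z‖ * (K * B) * (t - s) := by
      intro s hs t ht hst
      exact norm_image_sub_le_of_norm_deriv_right_le_segment (f := fun a => Y a z)
        ((hcont b hb.2).mono (Set.Icc_subset_Icc hs.1 ht.2))
        (fun a ha => hright a ⟨hs.1.trans ha.1, ha.2.trans_le ht.2⟩)
        (fun a ha => hbound a ⟨hs.1.trans ha.1, ha.2.trans_le ht.2⟩) t ⟨hst, le_rfl⟩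
    apply LipschitzOnWith.absolutelyContinuousOnInterval
      (K := ⟨‖z‖ * (K * B), by positivity⟩)
    rw [Set.uIcc_of_le hb.1]
    refine LipschitzOnWith.of_dist_le_mul fun s hs t ht => ?_
    rcases le_total s t with hst | hst
    · rw [dist_comm, dist_eq_norm, dist_comm s t, Real.dist_eq, abs_of_nonneg (sub_nonneg.2 hst)]
      exact hmain s hs t ht hst
    · rw [dist_eq_norm, Real.dist_eq, abs_of_nonneg (sub_nonneg.2 hst)]
      exact hmain t ht s hs hst
  · have hcount : (Set.range fun n : ℕ => q ^ ((n : ℝ) / 2)).Countable := Set.countable_range _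
    filter_upwards [ae_restrict_mem measurableSet_Ico,
      ae_restrict_of_ae (hcount.ae_notMem volume)] with a ha hna
    obtain ⟨n, hn, han⟩ := exists_mem_piece ha
    have ha0 : 0 < a := by linarith [ha.1]
    refine ⟨_, (hder n hn z a ha0).congr_of_eventuallyEq ?_, ?_⟩
    · obtain ⟨n, rfl⟩ : ∃ l, n = l + 1 := ⟨n - 1, by have := (Finset.mem_Icc.1 hn).1; omega⟩
      have han' := han
      rw [piece_succ] at han'
      have hlt : q ^ ((n : ℝ) / 2) < a := han'.1.lt_of_ne fun h => hna ⟨n, h⟩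
      filter_upwards [Ioo_mem_nhds hlt han'.2] with t ht
      exact hY (n + 1) hn t (by rw [piece_succ]; exact ⟨ht.1.le, ht.2⟩) z
    · rw [hH n hn a han, hY n hn a han z, canonicalField, smul_smul, neg_mul_neg,
        mul_inv_cancel₀ (by exact_mod_cast ha0.ne'), one_smul]
  · have h2g : 2 * g ∈ Finset.Icc 1 (2 * g) := Finset.mem_Icc.2 ⟨by omega, le_rfl⟩
    have hc := (hder (2 * g) h2g z (q ^ g) (by positivity)).continuousAt.tendsto
    rw [hend] at hc
    refine (hc.mono_left nhdsWithin_le_nhds).congr' ?_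
    have hlt := rpow_half_lt_succ hq (2 * g - 1)
    rw [show 2 * g - 1 + 1 = 2 * g by omega, rpow_two_mul_div_two] at hlt
    filter_upwards [Ico_mem_nhdsLT hlt] with t ht
    refine (hY (2 * g) h2g t ?_ z).symm
    have := piece_succ q (2 * g - 1)
    rw [show 2 * g - 1 + 1 = 2 * g by omega, rpow_two_mul_div_two] at this
    rwa [this]

end Glue


/-! ### The functions `A` and `B` on one piece -/

section Branch

variable {q : ℝ} {g : ℕ}

lemma ofReal_inv_cpow {b : ℝ} (hb : 0 < b) (w : ℂ) :
    ((b⁻¹ : ℝ) : ℂ) ^ w = (b : ℂ) ^ (-w) := by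
  rw [Complex.ofReal_inv, Complex.inv_cpow _ _ (by
    rw [Complex.arg_ofReal_of_nonneg hb.le]; exact Real.pi_pos.ne), Complex.cpow_neg]

lemma cFun_eq_of_inv {a : ℝ} {k l : ℤ} (hb : 0 < q ^ k / a) (h : q ^ l / a = (q ^ k / a)⁻¹)
    (z : ℂ) : cFun q l a z = cFun q k a z := by
  rw [cFun, cFun, h, ofReal_inv_cpow hb, ofReal_inv_cpow hb, neg_neg, add_comm]

lemma sFun_eq_neg_of_inv {a : ℝ} {k l : ℤ} (hb : 0 < q ^ k / a) (h : q ^ l / a = (q ^ k / a)⁻¹)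
    (z : ℂ) : sFun q l a z = -sFun q k a z := by
  rw [sFun, sFun, h, ofReal_inv_cpow hb, ofReal_inv_cpow hb, neg_neg, neg_sub]

lemma hasDerivAt_div_cpow {B a : ℝ} (hB : 0 < B) (ha : 0 < a) (w : ℂ) :
    HasDerivAt (fun t : ℝ => ((B / t : ℝ) : ℂ) ^ w) (-(w / a) * ((B / a : ℝ) : ℂ) ^ w) a := by
  have ha' : (a : ℂ) ≠ 0 := by exact_mod_cast ha.ne'
  have hB' : (B : ℂ) ≠ 0 := by exact_mod_cast hB.ne'
  have h1 : HasDerivAt (fun t : ℂ => (B : ℂ) / t) (B * (-((a : ℂ) ^ 2)⁻¹)) a := by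
    simpa only [div_eq_mul_inv] using (hasDerivAt_inv ha').const_mul (B : ℂ)
  have h2 := (h1.cpow_const (c := w) (by
    rw [← Complex.ofReal_div]
    exact Complex.ofReal_mem_slitPlane.2 (div_pos hB ha))).comp_ofReal
  have h3 : (fun t : ℝ => ((B / t : ℝ) : ℂ) ^ w) = fun t : ℝ => ((B : ℂ) / t) ^ w := by
    ext t; rw [Complex.ofReal_div]
  rw [h3]
  convert h2 using 1
  rw [Complex.cpow_sub _ _ (div_ne_zero hB' ha'), Complex.cpow_one, Complex.ofReal_div]
  field_simp

lemma hasDerivAt_cFun (hq : 0 < q) (k : ℤ) {a : ℝ} (ha : 0 < a) (z : ℂ) :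
    HasDerivAt (fun t => cFun q k t z) (-(Complex.I * z / a) * sFun q k a z) a := by
  have hB : 0 < q ^ k := zpow_pos hq k
  have h := (hasDerivAt_div_cpow hB ha (Complex.I * z)).fun_add
    (hasDerivAt_div_cpow hB ha (-(Complex.I * z)))
  refine HasDerivAt.congr_deriv (f := fun t => cFun q k t z) h ?_
  rw [sFun]
  ring

lemma hasDerivAt_sFun (hq : 0 < q) (k : ℤ) {a : ℝ} (ha : 0 < a) (z : ℂ) :
    HasDerivAt (fun t => sFun q k t z) (-(Complex.I * z / a) * cFun q k a z) a := by
  have hB : 0 < q ^ k := zpow_pos hq k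
  have h := (hasDerivAt_div_cpow hB ha (Complex.I * z)).fun_sub
    (hasDerivAt_div_cpow hB ha (-(Complex.I * z)))
  refine HasDerivAt.congr_deriv (f := fun t => sFun q k t z) h ?_
  rw [cFun]
  ring

/-- The functions `(A, B)` built from the coefficients `s 0, …, s N` and `s 0 / m, …, s N / m`. -/
def branch (g N : ℕ) (q : ℝ) (s : ℕ → ℝ) (m : ℝ) (z : ℂ) (a : ℝ) : Fin 2 → ℂ :=
  ![1 / 2 * ∑ j ∈ Finset.range (N + 1), cFun q ((g : ℤ) - (j : ℤ)) a z * (s j : ℂ),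
    1 / 2 * (-Complex.I * ∑ j ∈ Finset.range (N + 1),
      sFun q ((g : ℤ) - (j : ℤ)) a z * ((s j / m : ℝ) : ℂ))]

lemma hasDerivAt_branch (hq : 0 < q) (N : ℕ) (s : ℕ → ℝ) {m : ℝ} (hm : m ≠ 0) (z : ℂ) {a : ℝ}
    (ha : 0 < a) : HasDerivAt (branch g N q s m z)
      (canonicalField (diagHam m) z a (branch g N q s m z a)) a := by
  have hm' : (m : ℂ) ≠ 0 := by exact_mod_cast hm
  have ha' : (a : ℂ) ≠ 0 := by exact_mod_cast ha.ne'
  rw [canonicalField_diagHam, hasDerivAt_pi, Fin.forall_fin_two]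
  constructor
  · have h := (HasDerivAt.fun_sum (u := Finset.range (N + 1)) fun j _ =>
      (hasDerivAt_cFun hq ((g : ℤ) - (j : ℤ)) ha z).mul_const (s j : ℂ)).const_mul (1 / 2 : ℂ)
    have h' : HasDerivAt (fun t => branch g N q s m z t 0) _ a := h
    refine h'.congr_deriv ?_
    simp only [branch, Matrix.cons_val_zero, Matrix.cons_val_one, Matrix.cons_val_fin_one,
      Finset.mul_sum]
    refine Finset.sum_congr rfl fun j _ => ?_
    push_cast
    field_simp
  · have h := ((HasDerivAt.fun_sum (u := Finset.range (N + 1)) fun j _ =>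
      (hasDerivAt_sFun hq ((g : ℤ) - (j : ℤ)) ha z).mul_const
        ((s j / m : ℝ) : ℂ)).const_mul (-Complex.I)).const_mul (1 / 2 : ℂ)
    have h' : HasDerivAt (fun t => branch g N q s m z t 1) _ a := h
    refine h'.congr_deriv ?_
    simp only [branch, Matrix.cons_val_zero, Matrix.cons_val_one, Matrix.cons_val_fin_one,
      Finset.mul_sum]
    refine Finset.sum_congr rfl fun j _ => ?_
    push_cast
    field_simp
    linear_combination (z * cFun q ((g : ℤ) - (j : ℤ)) a z * s j) * Complex.I_sq

lemma sum_mul_schurStep {N : ℕ} {s : ℕ → ℝ} (h : s 0 - s (N + 1) ≠ 0) {f : ℕ → ℂ} {e : ℝ}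
    (hf : ∀ j ≤ N + 1, f (N + 1 - j) = e * f j) :
    ∑ j ∈ Finset.range (N + 1), f j * ((schurStep (N + 1) s j : ℝ) : ℂ) =
      (s 0 - e * s (N + 1)) / (s 0 - s (N + 1)) *
        ∑ j ∈ Finset.range (N + 1 + 1), f j * (s j : ℂ) := by
  have h' : (s 0 : ℂ) - s (N + 1) ≠ 0 := by exact_mod_cast h
  have e1 : ∑ j ∈ Finset.range (N + 1), f j * ((schurStep (N + 1) s j : ℝ) : ℂ) =
      ∑ j ∈ Finset.range (N + 1 + 1), f j * ((schurStep (N + 1) s j : ℝ) : ℂ) := by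
    rw [Finset.sum_range_succ _ (N + 1), schurStep_last]
    simp
  have e2 : ∑ j ∈ Finset.range (N + 1 + 1), f j * (s (N + 1 - j) : ℂ) =
      e * ∑ j ∈ Finset.range (N + 1 + 1), f j * (s j : ℂ) := by
    rw [← Finset.sum_range_reflect, Finset.mul_sum]
    refine Finset.sum_congr rfl fun j hj => ?_
    have hj' : j ≤ N + 1 := by simpa [Nat.lt_succ_iff] using hj
    rw [show N + 1 + 1 - 1 - j = N + 1 - j by omega, hf j hj',
      show N + 1 - (N + 1 - j) = j by omega, mul_assoc]
  have e3 : ∑ j ∈ Finset.range (N + 1 + 1), f j * ((schurStep (N + 1) s j : ℝ) : ℂ) =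
      (s 0 * ∑ j ∈ Finset.range (N + 1 + 1), f j * (s j : ℂ) -
        s (N + 1) * ∑ j ∈ Finset.range (N + 1 + 1), f j * (s (N + 1 - j) : ℂ)) /
        (s 0 - s (N + 1)) := by
    rw [Finset.mul_sum, Finset.mul_sum, ← Finset.sum_sub_distrib, Finset.sum_div]
    refine Finset.sum_congr rfl fun j _ => ?_
    simp only [schurStep]
    push_cast
    ring
  rw [e1, e3, e2]
  ring

lemma branch_eq_branch_schurStep (hq : 0 < q) {N : ℕ} {s : ℕ → ℝ} {m : ℝ} (hN : N + 1 ≤ 2 * g)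
    (h1 : s 0 - s (N + 1) ≠ 0) (h2 : s 0 + s (N + 1) ≠ 0) (hm : m ≠ 0) (z : ℂ) {a : ℝ}
    (ha : 0 < a) (ha2 : a ^ 2 = q ^ (2 * g - (N + 1))) :
    branch g (N + 1) q s m z a = branch g N q (schurStep (N + 1) s)
      (m * ((s 0 + s (N + 1)) / (s 0 - s (N + 1)))) z a := by
  have h1' : (s 0 : ℂ) - s (N + 1) ≠ 0 := by exact_mod_cast h1
  have h2' : (s 0 : ℂ) + s (N + 1) ≠ 0 := by exact_mod_cast h2
  have hm' : (m : ℂ) ≠ 0 := by exact_mod_cast hm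
  have hinv : ∀ j ≤ N + 1, q ^ ((g : ℤ) - ((N + 1 - j : ℕ) : ℤ)) / a =
      (q ^ ((g : ℤ) - (j : ℤ)) / a)⁻¹ := by
    intro j hj
    have hk : 0 < q ^ ((g : ℤ) - (j : ℤ)) := zpow_pos hq _
    rw [inv_div, div_eq_div_iff ha.ne' hk.ne', ← zpow_add₀ hq.ne', ← pow_two, ha2, ← zpow_natCast]
    congr 1
    omega
  have hpos : ∀ j : ℕ, 0 < q ^ ((g : ℤ) - (j : ℤ)) / a := fun j => div_pos (zpow_pos hq _) ha
  have hc := sum_mul_schurStep h1 (f := fun j => cFun q ((g : ℤ) - (j : ℤ)) a z) (e := 1)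
    (fun j hj => by
      rw [cFun_eq_of_inv (hpos j) (hinv j hj), Complex.ofReal_one, one_mul])
  have hs := sum_mul_schurStep h1 (f := fun j => sFun q ((g : ℤ) - (j : ℤ)) a z) (e := -1)
    (fun j hj => by
      rw [sFun_eq_neg_of_inv (hpos j) (hinv j hj), Complex.ofReal_neg, Complex.ofReal_one,
        neg_one_mul])
  simp only [Complex.ofReal_one, one_mul, Complex.ofReal_neg, neg_mul, sub_neg_eq_add] at hc hs
  rw [div_self h1', one_mul] at hc
  have hdiv : ∀ (n : ℕ) (t : ℕ → ℝ) (μ : ℝ), ∑ j ∈ Finset.range n,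
      sFun q ((g : ℤ) - (j : ℤ)) a z * ((t j / μ : ℝ) : ℂ) =
      (∑ j ∈ Finset.range n, sFun q ((g : ℤ) - (j : ℤ)) a z * (t j : ℂ)) / μ := by
    intro n t μ
    rw [Finset.sum_div]
    refine Finset.sum_congr rfl fun j _ => ?_
    rw [Complex.ofReal_div, mul_div_assoc]
  rw [branch, branch, hdiv, hdiv, hc, hs]
  congr 3
  congr 1
  push_cast
  field_simp

lemma branch_zero_end (hq : 0 < q) (s : ℕ → ℝ) (m : ℝ) (z : ℂ) :
    branch g 0 q s m z (q ^ g) = ![(s 0 : ℂ), 0] := by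
  have h : q ^ (g : ℤ) / q ^ g = 1 := by
    rw [zpow_natCast, div_self (pow_pos hq g).ne']
  simp only [branch, zero_add, Finset.sum_range_one, Nat.cast_zero, sub_zero, cFun, sFun, h,
    Complex.ofReal_one, Complex.one_cpow, sub_self, zero_mul, mul_zero]
  congr 1
  ring

end Branch

/-! ### The Hamiltonian and the solution -/

section Main

variable {g : ℕ} {q : ℝ} {c : Fin (g + 1) → ℝ} {ω : ℝ}

lemma Hqω_eq_diagHam (hq : 1 < q) {n : ℕ} (hn : n ∈ Finset.Icc 1 (2 * g)) {a : ℝ}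
    (ha : a ∈ piece q n) :
    Hqω c q ω a = diagHam (ratValue (mRat g n) (point c (q ^ ω))) := by
  have : mqω c q ω a = ratValue (mRat g n) (point c (q ^ ω)) := by
    rw [mqω, ← sum_indicator_piece hq hn
      (fun n _ => ratValue (mRat g n) (point c (q ^ ω))) ha]
  rw [Hqω, this, diagHam]

lemma ABqω_eq_branch (hq : 1 < q) {n : ℕ} (hn : n ∈ Finset.Icc 1 (2 * g)) {a : ℝ}
    (ha : a ∈ piece q n) {s : ℕ → ℝ} {m : ℝ}
    (hv : ∀ j < 2 * g - n + 1, HasVal (point c (q ^ ω)) (vRat g n j) (s j) ∧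
      HasVal (point c (q ^ ω)) (vRat g n (2 * g - n + 1 + j)) (s j / m)) (z : ℂ) :
    ABqω c q ω a z = branch g (2 * g - n) q s m z a := by
  rw [ABqω, sum_indicator_piece hq hn (fun n a => (1 / 2 : ℂ) •
      (!![1, 0; 0, -Complex.I] : Matrix (Fin 2) (Fin 2) ℂ).mulVec
        (applyT g n q a z fun j => ratValue (vRat g n j) (point c (q ^ ω)))) ha]
  have h1 : ∑ j ∈ Finset.range (2 * g - n + 1), cFun q ((g : ℤ) - (j : ℤ)) a z *
      (ratValue (vRat g n j) (point c (q ^ ω)) : ℂ) =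
      ∑ j ∈ Finset.range (2 * g - n + 1), cFun q ((g : ℤ) - (j : ℤ)) a z * (s j : ℂ) :=
    Finset.sum_congr rfl fun j hj => by rw [(hv j (Finset.mem_range.1 hj)).1.ratValue_eq]
  have h2 : ∑ j ∈ Finset.range (2 * g - n + 1), sFun q ((g : ℤ) - (j : ℤ)) a z *
      (ratValue (vRat g n (2 * g - n + 1 + j)) (point c (q ^ ω)) : ℂ) =
      ∑ j ∈ Finset.range (2 * g - n + 1), sFun q ((g : ℤ) - (j : ℤ)) a z * ((s j / m : ℝ) : ℂ) :=
    Finset.sum_congr rfl fun j hj => by rw [(hv j (Finset.mem_range.1 hj)).2.ratValue_eq]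
  rw [applyT, h1, h2, branch]
  ext i
  fin_cases i
  · simp
  · simp [mul_comm Complex.I]

lemma canonicalField_smul (H : Matrix (Fin 2) (Fin 2) ℝ) (z : ℂ) (a : ℝ) (κ : ℂ)
    (y : Fin 2 → ℂ) : canonicalField H z a (κ • y) = κ • canonicalField H z a y := by
  rw [canonicalField, canonicalField, Matrix.mulVec_smul, smul_comm z κ, smul_comm _ κ]

lemma isCanonicalSystem_of_schurStable (hg : 1 ≤ g) (hq : 1 < q)
    (h : SchurStable g (initReal c (q ^ ω))) :
    IsCanonicalSystem 1 (q ^ g) (HqωDomain c q ω) (Hqω c q ω) := by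
  have hx : q ^ ω ≠ 0 := (Real.rpow_pos_of_pos (by linarith) ω).ne'
  obtain ⟨μ, hμ, -, hm, -⟩ := h.values c hg hx
  have hμ' : ∀ n ∈ Finset.Icc 1 (2 * g), 0 < μ n := fun n hn => hμ n (Finset.mem_Icc.1 hn).2
  refine isCanonicalSystem_of_pieces hg hq hμ' (fun n hn a ha => ?_) (fun a ha => ?_)
  · rw [Hqω_eq_diagHam hq hn ha, (hm n hn).ratValue_eq]
  · obtain ⟨n, hn, han⟩ := exists_mem_piece ha
    refine ⟨n, hn, han, (hm n hn).ratDefined, ?_⟩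
    rw [(hm n hn).ratValue_eq]
    exact (hμ' n hn).ne'

lemma schurStable_of_isCanonicalSystem (hg : 1 ≤ g) (hq : 1 < q) (hc : c 0 ≠ 0)
    (h : IsCanonicalSystem 1 (q ^ g) (HqωDomain c q ω) (Hqω c q ω)) :
    SchurStable g (initReal c (q ^ ω)) := by
  have hx : q ^ ω ≠ 0 := (Real.rpow_pos_of_pos (by linarith) ω).ne'
  refine schurStable_of_ratValue_pos c hg hx hc fun n hn => ?_
  have hvol : volume (piece q n) ≠ 0 := by
    rw [piece, Real.volume_Ico, ne_eq, ENNReal.ofReal_eq_zero, not_le, sub_pos]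
    exact Real.rpow_lt_rpow_of_exponent_lt hq (by linarith)
  have hae : ∀ᵐ a ∂(volume.restrict (piece q n)),
      a ∈ HqωDomain c q ω ∧ (Hqω c q ω a).PosSemidef ∧ a ∈ piece q n := by
    have hle := ae_mono (Measure.restrict_mono (piece_subset hq hn) (le_refl volume))
    filter_upwards [hle h.defined, hle h.posSemidef,
      ae_restrict_mem (show MeasurableSet (piece q n) from measurableSet_Ico)] with a h1 h2 h3
    exact ⟨h1, h2, h3⟩
  have : (ae (volume.restrict (piece q n))).NeBot := by
    rwa [ae_neBot, ne_eq, Measure.restrict_eq_zero]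
  obtain ⟨a, ⟨n', hn', han', hdef, hne⟩, hpsd, han⟩ := hae.exists
  obtain rfl := piece_unique hq (Finset.mem_Icc.1 hn').1 (Finset.mem_Icc.1 hn).1 han' han
  rw [Hqω_eq_diagHam hq hn han, posSemidef_diagHam_iff hne] at hpsd
  exact ⟨hdef, hpsd⟩

lemma solution_of_schurStable (hg : 1 ≤ g) (hq : 1 < q)
    (h : SchurStable g (initReal c (q ^ ω))) (hE : Eqω c q ω 0 ≠ 0) :
    Set.Ico 1 (q ^ g) ⊆ ABqωDomain c q ω ∧ IsCanonicalSolution 1 (q ^ g) (Hqω c q ω)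
      (fun a z => (Eqω c q ω 0)⁻¹ • ABqω c q ω a z) := by
  have hq0 : 0 < q := by linarith
  have hx : q ^ ω ≠ 0 := (Real.rpow_pos_of_pos hq0 ω).ne'
  obtain ⟨μ, hμ, hrec, hm, hv⟩ := h.values c hg hx
  have hμ' : ∀ n ∈ Finset.Icc 1 (2 * g), 0 < μ n := fun n hn => hμ n (Finset.mem_Icc.1 hn).2
  constructor
  · intro a ha
    obtain ⟨n, hn, han⟩ := exists_mem_piece ha
    refine ⟨n, hn, han, fun j hj => ?_⟩
    have hn2 := (Finset.mem_Icc.1 hn).2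
    by_cases hjn : j < 2 * g - n + 1
    · exact (hv n hn2 j hjn).1.ratDefined
    · have := (hv n hn2 (j - (2 * g - n + 1)) (by omega)).2.ratDefined
      rwa [show 2 * g - n + 1 + (j - (2 * g - n + 1)) = j by omega] at this
  · refine isCanonicalSolution_of_pieces hg hq hμ' (fun n hn a ha => ?_)
      (y := fun n z a => (Eqω c q ω 0)⁻¹ •
        branch g (2 * g - n) q (schurSeq g (initReal c (q ^ ω)) n) (μ n) z a)
      (fun n hn a ha z => ?_) (fun n hn z a ha => ?_) (fun n hn z => ?_) (fun z => ?_)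
    · rw [Hqω_eq_diagHam hq hn ha, (hm n hn).ratValue_eq]
    · simp only [ABqω_eq_branch hq hn ha (hv n (Finset.mem_Icc.1 hn).2) z]
    · rw [canonicalField_smul]
      exact (hasDerivAt_branch hq0 _ _ (hμ' n hn).ne' z ha).fun_const_smul (Eqω c q ω 0)⁻¹
    · obtain ⟨h1, h2⟩ := Finset.mem_Ico.1 hn
      obtain ⟨N, hN⟩ : ∃ N, 2 * g - n = N + 1 := ⟨2 * g - n - 1, by omega⟩
      obtain ⟨r1, r2⟩ := h.regular n h2
      simp only [hrec n h2, schurSeq, hN, show 2 * g - (n + 1) = N by omega] at r1 r2 ⊢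
      rw [branch_eq_branch_schurStep hq0 (by omega) r1 r2 (hμ n h2.le).ne' z
        (Real.rpow_pos_of_pos hq0 _)]
      rw [← Real.rpow_mul_natCast hq0.le, ← Real.rpow_natCast, ← hN,
        show 2 * g - (2 * g - n) = n by omega]
      congr 1
      push_cast
      ring
    · have hend := h.polyVal_one (n := 2 * g) le_rfl
      rw [← Eqω_zero c hq0] at hend
      simp only [polyVal, tsub_self, zero_add, Finset.sum_range_one, pow_zero, mul_one] at hend
      simp only [tsub_self, branch_zero_end hq0, hend]
      ext i
      fin_cases i <;> simp [hE]

end Main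

end SelfReciprocal

end

theorem corollary2 (g : ℕ) (hg : 1 ≤ g) (q : ℝ) (hq : 1 < q)
    (c : Fin (g + 1) → ℝ) (hc : c 0 ≠ 0) :
    ((∀ ω : ℝ, 0 < ω →
        SelfReciprocal.IsCanonicalSystem 1 (q ^ g)
          (SelfReciprocal.HqωDomain c q ω) (SelfReciprocal.Hqω c q ω)) ↔
      ∀ x : ℂ, Polynomial.aeval x (SelfReciprocal.polyP c) = 0 → ‖x‖ = 1) ∧
    ∀ ω : ℝ, 0 < ω →
      SelfReciprocal.IsCanonicalSystem 1 (q ^ g)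
        (SelfReciprocal.HqωDomain c q ω) (SelfReciprocal.Hqω c q ω) →
      SelfReciprocal.Eqω c q ω 0 ≠ 0 ∧
      Set.Ico 1 (q ^ g) ⊆ SelfReciprocal.ABqωDomain c q ω ∧
      SelfReciprocal.IsCanonicalSolution 1 (q ^ g) (SelfReciprocal.Hqω c q ω)
        (fun a z => (SelfReciprocal.Eqω c q ω 0)⁻¹ • SelfReciprocal.ABqω c q ω a z) := by

  have hq0 : 0 < q := by linarith
  have hne : ∀ ω : ℝ, SelfReciprocal.initReal c (q ^ ω) 0 ≠ 0 := fun ω => by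
    rw [SelfReciprocal.initReal_zero]
    exact mul_ne_zero hc (zpow_ne_zero _ (Real.rpow_pos_of_pos hq0 ω).ne')
  have hiff : ∀ ω : ℝ, SelfReciprocal.IsCanonicalSystem 1 (q ^ g)
      (SelfReciprocal.HqωDomain c q ω) (SelfReciprocal.Hqω c q ω) ↔
      SelfReciprocal.DiscFree (2 * g) (SelfReciprocal.initReal c (q ^ ω)) := fun ω => by
    rw [← SelfReciprocal.schurStable_iff_discFree (hne ω)]
    exact ⟨SelfReciprocal.schurStable_of_isCanonicalSystem hg hq hc,
      SelfReciprocal.isCanonicalSystem_of_schurStable hg hq⟩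
  refine ⟨?_, fun ω _ h => ?_⟩
  · rw [← SelfReciprocal.forall_discFree_iff c hq]
    exact forall₂_congr fun ω _ => hiff ω
  · have hE : SelfReciprocal.Eqω c q ω 0 ≠ 0 := by
      rw [SelfReciprocal.Eqω_zero c hq0]
      exact (hiff ω).1 h 1 (by simp)
    exact ⟨hE, SelfReciprocal.solution_of_schurStable hg hq
      (SelfReciprocal.schurStable_of_isCanonicalSystem hg hq hc h) hE⟩
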